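/- Let $m,n$ be natural numbers and let $B_1,\dots,B_m$ be real orthogonal $n\times n$ matrices with $B_i^{-1}B_j=-B_j^{-1}B_i$ for $i\ne j$. Let $k\in\mathbb Z^m\setminus\{0\}$, $B_k=k_1B_1+\cdots+k_mB_m$ and $\|k\|_2=(k_1^2+\cdots+k_m^2)^{1/2}$. Let $\mathbb G=\mathbb R^n\times\mathbb R^n\times\mathbb T^m$, $\mathbb T=\mathbb R/2\pi\mathbb Z$, be the (underlying space of the) reduced Heisenberg group with $m$-dimensional centre, with measure $dq\,dp\,dt$, and let $\pi_k$ be the representation on $L^2(\mathbb R^n)$ $$\pi_k(q,p,t)f(x)=e^{ik\cdot t}\,e^{iq\cdot B_k(x+p/2)}f(x+p).$$ Let $\varphi(x)=2^{n/4}e^{-|x|^2/2}$, and let $c_\varphi=\|\varphi\|^{-2}\int_{\mathbb G}|\langle\varphi,\pi_k(g)\varphi\rangle|^2\,dg$ be the constant of the resolution of the identity $\langle f,h\rangle=c_\varphi^{-1}\int_{\mathbb G}\langle f,\pi_k(g)\varphi\rangle\langle\pi_k(g)\varphi,h\rangle\,dg$. For $F\in L^2(\mathbb R^{2n})$ let $L^k_{F,\varphi}:L^2(\mathbb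 R^n)\to L^2(\mathbb R^n)$ be the localization operator $$L^k_{F,\varphi}f=\frac1{c_\varphi}\int_{\mathbb G}F(q,p)\,\langle f,\pi_k(q,p,t)\varphi\rangle\,\pi_k(q,p,t)\varphi\;dq\,dp\,dt .$$ Put $F^k(q,p)=F\big(B_kp/\|k\|_2^2,\,-B_k^{t}q/\|k\|_2^2\big)$, let $\widehat{\ }$ be the unitary Fourier transform on $L^2(\mathbb R^{2n})$, given by $\widehat f(w)=(2\pi)^{-n}\int e^{-iw\cdot z}f(z)\,dz$ for $f\in L^1\cap L^2$, and define $$(\Phi\circledast\Psi)(\xi,\eta)=\int_{\mathbb R^{2n}}\Phi(\xi-q,\eta-p)\Psi(q,p)\,e^{-\frac{|p|^2}2-\frac{\|k\|_2^2|q|^2}2}\,e^{\frac{\langle\eta,p\rangle}2+\frac{\|k\|_2^2\langle\xi,q\rangle}2}\,e^{\frac i2\sum_{j=1}^m k_j(q\cdot B_j\eta-\xi\cdot B_jp)}\,dq\,dp$$ whenever the integral exists. Let $F,G,H\in L^2(\mathbb R^{2n})$ satisfy $L^k_{H,\varphi}=L^k_{F,\varphi}L^k_{G,\varphi}$. Then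 the integral defining $(\widehat{F^k}\circledast\widehat{G^k})(\xi,\eta)$ converges absolutely for every $(\xi,\eta)\in\mathbb R^{2n}$, and $$\widehat{H^k}(\xi,\eta)=(2\pi)^{-n}\big(\widehat{F^k}\circledast\widehat{G^k}\big)(\xi,\eta)\qquad\text{for almost every }(\xi,\eta)\in\mathbb R^{2n}.$$ -/

import Mathlib

open MeasureTheory
open scoped Real InnerProductSpace FourierTransform

noncomputable section

namespace ReducedHeisenberg

/-- The Euclidean space `ℝⁿ`. -/
abbrev E (n : ℕ) := EuclideanSpace ℝ (Fin n)

/-- The Euclidean space `ℝ²ⁿ = ℝⁿ × ℝⁿ`, with points `z = (q, p)`, `q = z.fst`, `p = z.snd`. -/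
abbrev R2 (n : ℕ) := WithLp 2 (E n × E n)

/-- The complex Hilbert space `L²(ℝⁿ)`. -/
abbrev L2 (n : ℕ) := Lp ℂ 2 (volume : Measure (E n))

instance two_pi_fact : Fact (0 < 2 * π) := ⟨Real.two_pi_pos⟩

/-- The underlying measure space of the reduced Heisenberg group `ℝⁿ × ℝⁿ × 𝕋ᵐ`, where
`𝕋 = ℝ / 2πℤ` has total mass `2π`; its volume is the Haar measure `dq dp dt`. -/
abbrev RedHeis (m n : ℕ) := R2 n × (Fin m → AddCircle (2 * π))

section

variable {m n : ℕ}

/-- A matrix acting on `ℝⁿ`. -/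
abbrev act (A : Matrix (Fin n) (Fin n) ℝ) (x : E n) : E n := Matrix.toEuclideanLin A x

/-- The matrix `B_k = k₁ B₁ + ⋯ + k_m B_m`. -/
def Bk (B : Fin m → Matrix (Fin n) (Fin n) ℝ) (k : Fin m → ℤ) : Matrix (Fin n) (Fin n) ℝ :=
  ∑ j, (k j : ℝ) • B j

/-- The square of the Euclidean norm of `k`. -/
def normSqK (k : Fin m → ℤ) : ℝ := ∑ j, (k j : ℝ) ^ 2

/-- `[w, z]_j = q · B_j η - ξ · B_j p` for `w = (ξ, η)` and `z = (q, p)`. -/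
def bracket (B : Fin m → Matrix (Fin n) (Fin n) ℝ) (w z : R2 n) (j : Fin m) : ℝ :=
  ⟪z.fst, act (B j) w.snd⟫_ℝ - ⟪w.fst, act (B j) z.snd⟫_ℝ

/-- The character `t ↦ e^{i k · t}` of the torus. -/
def torusChar (k : Fin m → ℤ) (t : Fin m → AddCircle (2 * π)) : ℂ :=
  ∏ j, fourier (k j) (t j)

/-- The function `x ↦ e^{i k · t} e^{i q · B_k (x + p / 2)} f (x + p)`. -/
def repFun (B : Fin m → Matrix (Fin n) (Fin n) ℝ) (k : Fin m → ℤ) (g : RedHeis m n)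
    (f : E n → ℂ) (x : E n) : ℂ :=
  torusChar k g.2 *
    Complex.exp (Complex.I *
      ((⟪g.1.fst, act (Bk B k) (x + (1 / 2 : ℝ) • g.1.snd)⟫_ℝ : ℝ) : ℂ)) *
    f (x + g.1.snd)

theorem memLp_repFun (B : Fin m → Matrix (Fin n) (Fin n) ℝ) (k : Fin m → ℤ) (g : RedHeis m n)
    {f : E n → ℂ} (hf : MemLp f 2 volume) : MemLp (repFun B k g f) 2 volume := by
  have h1 : MemLp (fun x => f (x + g.1.snd)) 2 volume :=
    hf.comp_measurePreserving (measurePreserving_add_right volume g.1.snd)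
  have hc : Continuous fun x : E n => torusChar k g.2 *
      Complex.exp (Complex.I *
        ((⟪g.1.fst, act (Bk B k) (x + (1 / 2 : ℝ) • g.1.snd)⟫_ℝ : ℝ) : ℂ)) := by
    have : Continuous (Matrix.toEuclideanLin (Bk B k)) := LinearMap.continuous_of_finiteDimensional _
    fun_prop
  refine MemLp.of_le_mul (c := ‖torusChar k g.2‖) h1
    (hc.aestronglyMeasurable.mul h1.aestronglyMeasurable) (Filter.Eventually.of_forall fun x => ?_)
  simp only [repFun, norm_mul]
  rw [mul_comm Complex.I, Complex.norm_exp_ofReal_mul_I, mul_one]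

/-- The Schrödinger representation `π_k(q, p, t)` on `L²(ℝⁿ)`. -/
def rep (B : Fin m → Matrix (Fin n) (Fin n) ℝ) (k : Fin m → ℤ) (g : RedHeis m n) (f : L2 n) : L2 n :=
  (memLp_repFun B k g (Lp.memLp f)).toLp (repFun B k g f)

/-- The constant `c_φ` of the resolution of the identity
`⟨f, f'⟩ = c_φ⁻¹ ∫ ⟨f, π_k(g) φ⟩ ⟨π_k(g) φ, f'⟩ dg`; taking `f = f' = φ` there gives this value. -/
def admissibilityConst (B : Fin m → Matrix (Fin n) (Fin n) ℝ) (k : Fin m → ℤ) (φ : L2 n) : ℝ :=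
  (∫ g : RedHeis m n, ‖⟪rep B k g φ, φ⟫_ℂ‖ ^ 2) / ‖φ‖ ^ 2

/-- The localization operator
`L f = c_φ⁻¹ ∫ σ(g) ⟨f, π_k(g) φ⟩ π_k(g) φ dg` with symbol `σ` on the group (an `L²(ℝⁿ)`-valued
integral; note that Mathlib's inner product is linear in the second variable). -/
def locOpG (B : Fin m → Matrix (Fin n) (Fin n) ℝ) (k : Fin m → ℤ) (φ : L2 n) (σ : RedHeis m n → ℂ)
    (f : L2 n) : L2 n :=
  ((admissibilityConst B k φ : ℂ))⁻¹ • ∫ g : RedHeis m n, (σ g * ⟪rep B k g φ, f⟫_ℂ) • rep B k g φ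

/-- The localization operator `L^k_{F,φ}`, whose symbol is `σ(q, p, t) = F(q, p)`. -/
def locOp (B : Fin m → Matrix (Fin n) (Fin n) ℝ) (k : Fin m → ℤ) (φ : L2 n) (F : R2 n → ℂ) :
    L2 n → L2 n :=
  locOpG B k φ fun g => F g.1

/-- `F^k(q, p) = F(B_k p / ‖k‖², -B_kᵗ q / ‖k‖²)`. -/
def twist (B : Fin m → Matrix (Fin n) (Fin n) ℝ) (k : Fin m → ℤ) (F : R2 n → ℂ) (z : R2 n) : ℂ :=
  F (WithLp.toLp 2
    ((normSqK k)⁻¹ • act (Bk B k) z.snd, -((normSqK k)⁻¹ • act (Bk B k).transpose z.fst)))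

/-- The integrand, as a function of `z = (q, p)`, of the new convolution at `w = (ξ, η)`. -/
def newConvIntegrand (B : Fin m → Matrix (Fin n) (Fin n) ℝ) (k : Fin m → ℤ) (F G : R2 n → ℂ)
    (w z : R2 n) : ℂ :=
  F (w - z) * G z *
    Real.exp (-(‖z.snd‖ ^ 2 / 2) - normSqK k * ‖z.fst‖ ^ 2 / 2) *
    Real.exp (⟪w.snd, z.snd⟫_ℝ / 2 + normSqK k * ⟪w.fst, z.fst⟫_ℝ / 2) *
    Complex.exp (Complex.I / 2 * ((∑ j, (k j : ℝ) * bracket B w z j : ℝ) : ℂ))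

/-- The new convolution `F ⊛ G`. -/
def newConv (B : Fin m → Matrix (Fin n) (Fin n) ℝ) (k : Fin m → ℤ) (F G : R2 n → ℂ)
    (w : R2 n) : ℂ :=
  ∫ z, newConvIntegrand B k F G w z

end

section

variable {n : ℕ}

open Classical in
/-- The unitary Fourier transform on `L²(ℝ²ⁿ)`, the continuous extension of
`f̂(w) = (2π)⁻ⁿ ∫ e^{-i w · z} f(z) dz` (Mathlib's `𝓕` has the kernel `e^{-2π i w · z}`).
It is determined up to null sets, and set to `0` on functions that are not in `L²`. -/
def l2Fourier (f : R2 n → ℂ) : R2 n → ℂ :=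
  if hf : MemLp f 2 volume then
    fun w => ((2 * π : ℝ) : ℂ)⁻¹ ^ n * (𝓕 (hf.toLp f)) ((2 * π)⁻¹ • w)
  else 0

end

/-- The Gaussian `x ↦ 2^{n/4} e^{-|x|²/2}`. -/
def gaussFun (n : ℕ) (x : E n) : ℂ :=
  (((2 : ℝ) ^ ((n : ℝ) / 4) * Real.exp (-(‖x‖ ^ 2 / 2)) : ℝ) : ℂ)

theorem memLp_gaussFun (n : ℕ) : MemLp (gaussFun n) 2 volume := by
  have hc : Continuous (gaussFun n) := by unfold gaussFun; fun_prop
  rw [memLp_two_iff_integrable_sq_norm hc.aestronglyMeasurable]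
  have h := (GaussianFourier.integrable_cexp_neg_mul_sq_norm_add (V := E n) (b := 1)
    (by simp) 0 0).norm.const_mul (((2 : ℝ) ^ ((n : ℝ) / 4)) ^ 2)
  refine h.congr (Filter.Eventually.of_forall fun x => ?_)
  have hpos : 0 < (2 : ℝ) ^ ((n : ℝ) / 4) * Real.exp (-(‖x‖ ^ 2 / 2)) := by positivity
  simp only [gaussFun, Complex.norm_real, Real.norm_eq_abs, abs_of_pos hpos, mul_pow,
    Complex.norm_exp]
  rw [← Real.exp_nat_mul]
  congr 2
  norm_cast
  simp only [inner_zero_left]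
  push_cast
  ring_nf

/-- The Gaussian wavelet `φ(x) = 2^{n/4} e^{-|x|²/2}` as an element of `L²(ℝⁿ)`. -/
def gaussWavelet (n : ℕ) : L2 n := (memLp_gaussFun n).toLp (gaussFun n)

end ReducedHeisenberg

end

open ReducedHeisenberg

/-! ### Gaussian integrals with complex linear terms on `ℝⁿ` and `ℝ²ⁿ`. -/

namespace ReducedHeisenberg

variable {n : ℕ}

/-! Write κ = ‖k‖², T = B_k, S = Tᵗ. The anticommutation relations give TᵗT = κ·1, so T and S are √κ
times isometries, and every kernel below is an explicit Gaussian.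

Only diagonal matrix elements between coherent states π_k(a,0)φ are needed. The overlap of two such
states is a constant times a Gaussian kernel K. Pairing L_H = L_F L_G with the state at a on both
sides gives, for every a, ∫ H(z) K(a,z)K(z,a) dz = c ∫∫ F(z) G(z') K(a,z)K(z,z')K(z',a) dz' dz
(`integral_cohKer_eq_of_locOp_comp`). The twist in F^k is a dilation composed with an isometry and
turns K into `ker` (`cohKer_twistMap`).

The left side is then a Gaussian convolution of H^k, hence the inverse Fourier transform at a, up to
constants, of Ĥ^k times a Gaussian. On the right, the triple product is the Fourier transform in
both variables of `kerHat` z ζ · e^{ia·(z+ζ)} (`integral_integral_kerHat`). Substituting w = z + ζ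
makes the right side a transform in w as well. Injectivity of the Fourier transform on L¹ identifies
the two integrands a.e. (`l2Fourier_mul_gau_ae_eq`). Finally `kerHat` (w-z) z is the weight of ⊛
times the same Gaussian in w (`gau_mul_newConvIntegrand`), which never vanishes and is divided out.
-/

theorem ofReal_cpow_natCast_div_two {x : ℝ} (hx : 0 ≤ x) (n : ℕ) :
    (x : ℂ) ^ ((n : ℂ) / 2) = ((√x ^ n : ℝ) : ℂ) := by
  rw [Real.sqrt_eq_rpow, ← Real.rpow_natCast, ← Real.rpow_mul hx, Complex.ofReal_cpow hx]
  push_cast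
  ring_nf

theorem gaussExponent_eq_sum (b : ℝ) (α β v : E n) :
    (((-(b * ‖v‖ ^ 2) + ⟪α, v⟫_ℝ : ℝ) : ℂ) + Complex.I * (⟪β, v⟫_ℝ : ℝ)) =
      -(b : ℂ) * ∑ i, ((v i : ℝ) : ℂ) ^ 2 + ∑ i, ((α i : ℂ) + Complex.I * β i) * (v i : ℂ) := by
  simp only [EuclideanSpace.real_norm_sq_eq, PiLp.inner_apply, RCLike.inner_apply, conj_trivial]
  push_cast
  simp only [add_mul, Finset.sum_add_distrib, Finset.mul_sum]
  rw [← add_assoc, ← Finset.sum_neg_distrib]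
  congr 1
  · congr 1
    · exact Finset.sum_congr rfl fun i _ => by ring
    · exact Finset.sum_congr rfl fun i _ => by ring
  · exact Finset.sum_congr rfl fun i _ => by ring

theorem integrable_gauss {b : ℝ} (hb : 0 < b) (α β : E n) :
    Integrable fun v : E n => Complex.exp (((-(b * ‖v‖ ^ 2) + ⟪α, v⟫_ℝ : ℝ) : ℂ) +
      Complex.I * (⟪β, v⟫_ℝ : ℝ)) := by
  simp_rw [gaussExponent_eq_sum]
  rw [← (PiLp.volume_preserving_toLp (Fin n)).integrable_comp_emb
    (MeasurableEquiv.toLp 2 _).measurableEmbedding]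
  exact GaussianFourier.integrable_cexp_neg_mul_sum_add (b := (b : ℂ)) (by simpa using hb) _

theorem integral_gauss {b : ℝ} (hb : 0 < b) (α β : E n) :
    ∫ v : E n, Complex.exp (((-(b * ‖v‖ ^ 2) + ⟪α, v⟫_ℝ : ℝ) : ℂ) +
      Complex.I * (⟪β, v⟫_ℝ : ℝ)) =
    ((√(π / b) ^ n : ℝ) : ℂ) * Complex.exp ((((‖α‖ ^ 2 - ‖β‖ ^ 2) / (4 * b) : ℝ) : ℂ) +
      Complex.I * (⟪α, β⟫_ℝ / (2 * b) : ℝ)) := by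
  simp_rw [gaussExponent_eq_sum]
  rw [← (PiLp.volume_preserving_toLp (Fin n)).integral_comp
    (MeasurableEquiv.toLp 2 _).measurableEmbedding]
  rw [GaussianFourier.integral_cexp_neg_mul_sum_add (b := (b : ℂ)) (by simpa using hb),
    Fintype.card_fin, ← Complex.ofReal_div, ofReal_cpow_natCast_div_two (by positivity)]
  congr 2
  have hb' : (b : ℂ) ≠ 0 := by exact_mod_cast hb.ne'
  simp only [EuclideanSpace.real_norm_sq_eq, PiLp.inner_apply, RCLike.inner_apply, conj_trivial]
  push_cast
  -- Completing the square produces the bilinear, not Hermitian, square of α + iβ; its real part is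
  -- ‖α‖² - ‖β‖².
  have : ∑ i, ((α i : ℂ) + Complex.I * β i) ^ 2 =
      (∑ i, (α i : ℂ) ^ 2 - ∑ i, (β i : ℂ) ^ 2) + 2 * Complex.I * ∑ i, (β i : ℂ) * α i := by
    rw [Finset.mul_sum, ← Finset.sum_sub_distrib, ← Finset.sum_add_distrib]
    refine Finset.sum_congr rfl fun i _ => ?_
    linear_combination (β i : ℂ) ^ 2 * Complex.I_sq
  rw [this]
  field_simp
  ring

/-- The Gaussian `z ↦ exp (-b |z₁|² - c |z₂|² + α · z + i β · z)` on `ℝ²ⁿ`. -/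
noncomputable def gau (b c : ℝ) (α β z : R2 n) : ℂ :=
  Complex.exp (((-(b * ‖z.fst‖ ^ 2) - c * ‖z.snd‖ ^ 2 + ⟪α, z⟫_ℝ : ℝ) : ℂ) +
    Complex.I * (⟪β, z⟫_ℝ : ℝ))

theorem inner_R2 (w z : R2 n) : ⟪w, z⟫_ℝ = ⟪w.fst, z.fst⟫_ℝ + ⟪w.snd, z.snd⟫_ℝ :=
  WithLp.prod_inner_apply w z

theorem gau_eq_mul (b c : ℝ) (α β z : R2 n) :
    gau b c α β z =
      Complex.exp (((-(b * ‖z.fst‖ ^ 2) + ⟪α.fst, z.fst⟫_ℝ : ℝ) : ℂ) +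
        Complex.I * (⟪β.fst, z.fst⟫_ℝ : ℝ)) *
      Complex.exp (((-(c * ‖z.snd‖ ^ 2) + ⟪α.snd, z.snd⟫_ℝ : ℝ) : ℂ) +
        Complex.I * (⟪β.snd, z.snd⟫_ℝ : ℝ)) := by
  rw [gau, ← Complex.exp_add, inner_R2, inner_R2]
  congr 1
  push_cast
  ring

theorem continuous_gau (b c : ℝ) (α β : R2 n) : Continuous (gau b c α β) := by
  unfold gau
  fun_prop

theorem norm_gau (b c : ℝ) (α β z : R2 n) :
    ‖gau b c α β z‖ = Real.exp (-(b * ‖z.fst‖ ^ 2) - c * ‖z.snd‖ ^ 2 + ⟪α, z⟫_ℝ) := by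
  rw [gau, Complex.norm_exp, Complex.add_re, Complex.ofReal_re, Complex.re_mul_ofReal,
    Complex.I_re, zero_mul, add_zero]

theorem integrable_gau {b c : ℝ} (hb : 0 < b) (hc : 0 < c) (α β : R2 n) :
    Integrable (gau b c α β) := by
  rw [← (WithLp.volume_preserving_toLp (E n) (E n)).integrable_comp_emb
    (MeasurableEquiv.toLp 2 _).measurableEmbedding]
  refine ((integrable_gauss hb α.fst β.fst).mul_prod (integrable_gauss hc α.snd β.snd)).congr ?_
  exact Filter.Eventually.of_forall fun z => (gau_eq_mul b c α β _).symm

theorem integral_gau {b c : ℝ} (hb : 0 < b) (hc : 0 < c) (α β : R2 n) :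
    ∫ z, gau b c α β z = ((√(π / b) ^ n * √(π / c) ^ n : ℝ) : ℂ) *
      Complex.exp ((((‖α.fst‖ ^ 2 - ‖β.fst‖ ^ 2) / (4 * b) +
        (‖α.snd‖ ^ 2 - ‖β.snd‖ ^ 2) / (4 * c) : ℝ) : ℂ) +
      Complex.I * (⟪α.fst, β.fst⟫_ℝ / (2 * b) + ⟪α.snd, β.snd⟫_ℝ / (2 * c) : ℝ)) := by
  rw [← (WithLp.volume_preserving_toLp (E n) (E n)).integral_comp
    (MeasurableEquiv.toLp 2 _).measurableEmbedding]
  simp_rw [gau_eq_mul]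
  have := integral_prod_mul (μ := (volume : Measure (E n))) (ν := (volume : Measure (E n)))
    (fun v : E n => Complex.exp (((-(b * ‖v‖ ^ 2) + ⟪α.fst, v⟫_ℝ : ℝ) : ℂ) +
        Complex.I * (⟪β.fst, v⟫_ℝ : ℝ)))
    (fun v : E n => Complex.exp (((-(c * ‖v‖ ^ 2) + ⟪α.snd, v⟫_ℝ : ℝ) : ℂ) +
        Complex.I * (⟪β.snd, v⟫_ℝ : ℝ)))
  refine this.trans ?_
  rw [integral_gauss hb, integral_gauss hc, mul_mul_mul_comm, ← Complex.exp_add]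
  push_cast
  ring_nf

theorem memLp_gau {b c : ℝ} (hb : 0 < b) (hc : 0 < c) (α β : R2 n) :
    MemLp (gau b c α β) 2 volume := by
  rw [memLp_two_iff_integrable_sq_norm (continuous_gau b c α β).aestronglyMeasurable]
  refine (integrable_gau (b := 2 * b) (c := 2 * c) (by positivity) (by positivity)
    ((2 : ℝ) • α) 0).norm.congr (Filter.Eventually.of_forall fun z => ?_)
  simp only [norm_gau, ← Real.exp_nat_mul, real_inner_smul_left]
  congr 1
  push_cast
  ring

end ReducedHeisenberg

/-! ### Fourier transform on L²: bilinear Parseval formula and injectivity on L¹. -/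

namespace ReducedHeisenberg

section Fourier

variable {V : Type*} [NormedAddCommGroup V] [InnerProductSpace ℝ V] [FiniteDimensional ℝ V]
  [MeasurableSpace V] [BorelSpace V]

theorem integral_fourier_mul_eq {f g : V → ℂ} (hf : Integrable f) (hg : Integrable g) :
    ∫ w, 𝓕 f w * g w = ∫ z, f z * 𝓕 g z := by
  simpa using! VectorFourier.integral_fourierIntegral_smul_eq_flip (L := innerₗ V)
      Real.continuous_fourierChar continuous_inner hf hg

theorem integral_Lp_mul_eq_inner {g : V → ℂ} (hg : MemLp g 2 volume)
    (f : Lp ℂ 2 (volume : Measure V)) : ∫ w, f w * g w = ⟪hg.star.toLp (star g), f⟫_ℂ := by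
  rw [L2.inner_def]
  refine integral_congr_ae ?_
  filter_upwards [hg.star.coeFn_toLp] with w hw
  rw [hw]
  simp

theorem integral_toLp_fourier_mul_eq {g : V → ℂ} (hg : Integrable g) (φ : SchwartzMap V ℂ) :
    ∫ w, (𝓕 (φ.toLp 2) : Lp ℂ 2 (volume : Measure V)) w * g w =
      ∫ z, (φ.toLp 2 : Lp ℂ 2 (volume : Measure V)) z * 𝓕 g z := by
  have h1 : ∀ᵐ w, (𝓕 (φ.toLp 2) : Lp ℂ 2 (volume : Measure V)) w * g w =
      𝓕 (φ : V → ℂ) w * g w := by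
    rw [SchwartzMap.toLp_fourier_eq]
    filter_upwards [SchwartzMap.coeFn_toLp (𝓕 φ) 2 volume] with w hw
    rw [hw, SchwartzMap.fourier_coe]
  have h2 : ∀ᵐ w, (φ.toLp 2 : Lp ℂ 2 (volume : Measure V)) w * 𝓕 g w = φ w * 𝓕 g w := by
    filter_upwards [SchwartzMap.coeFn_toLp φ 2 volume] with w hw
    rw [hw]
  rw [integral_congr_ae h1, integral_congr_ae h2]
  exact integral_fourier_mul_eq φ.integrable hg

/-- Both sides are continuous in f ∈ L², because g and its transform are in L², and they agree on
the dense set of Schwartz functions. -/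
theorem integral_Lp_fourier_mul_eq {g : V → ℂ} (hg : Integrable g) (hg2 : MemLp g 2 volume)
    (hG : MemLp (𝓕 g) 2 volume) (f : Lp ℂ 2 (volume : Measure V)) :
    ∫ w, (𝓕 f : Lp ℂ 2 (volume : Measure V)) w * g w = ∫ z, f z * 𝓕 g z := by
  have hclosed : IsClosed {f : Lp ℂ 2 (volume : Measure V) |
      ∫ w, (𝓕 f : Lp ℂ 2 (volume : Measure V)) w * g w = ∫ z, f z * 𝓕 g z} := by
    simp_rw [integral_Lp_mul_eq_inner hg2, integral_Lp_mul_eq_inner hG]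
    refine isClosed_eq ?_ (by fun_prop)
    exact continuous_const.inner (Lp.fourierTransformₗᵢ V ℂ).continuous
  have hrange : Set.range (SchwartzMap.toLpCLM ℂ (E := V) ℂ 2 volume) ⊆
      {f : Lp ℂ 2 (volume : Measure V) |
      ∫ w, (𝓕 f : Lp ℂ 2 (volume : Measure V)) w * g w = ∫ z, f z * 𝓕 g z} := by
    rintro _ ⟨φ, rfl⟩
    exact integral_toLp_fourier_mul_eq hg φ
  exact hclosed.closure_subset_iff.2 hrange
    ((SchwartzMap.denseRange_toLpCLM (p := 2) ENNReal.ofNat_ne_top) f)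

/-- Test against a smooth compactly supported χ. As χ is the transform of a Schwartz function, the
pairing with χ only sees the transforms of f and g. -/
theorem ae_eq_of_fourier_eq {f g : V → ℂ} (hf : Integrable f) (hg : Integrable g)
    (h : 𝓕 f = 𝓕 g) : f =ᵐ[volume] g := by
  refine ae_eq_of_integral_contDiff_smul_eq hf.locallyIntegrable hg.locallyIntegrable
    fun χ hχ hχs => ?_
  let χ' : SchwartzMap V ℂ := (hχs.comp_left (g := ((↑) : ℝ → ℂ)) rfl).toSchwartzMap
    (Complex.ofRealCLM.contDiff.comp hχ)
  have key (a : V → ℂ) (ha : Integrable a) :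
      ∫ x, χ x • a x = ∫ x, (𝓕⁻ χ' : SchwartzMap V ℂ) x * 𝓕 a x := by
    rw [← integral_fourier_mul_eq (SchwartzMap.integrable _) ha]
    refine integral_congr_ae (Filter.Eventually.of_forall fun x => ?_)
    have h1 : 𝓕 ((𝓕⁻ χ' : SchwartzMap V ℂ) : V → ℂ) = χ' := by
      rw [← SchwartzMap.fourier_coe, FourierTransform.fourier_fourierInv_eq]
    simp only [h1, Complex.real_smul]
    rfl
  rw [key f hf, key g hg, h]

end Fourier

end ReducedHeisenberg

/-! ### The unitary transform `l2Fourier` paired with Gaussians. -/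

namespace ReducedHeisenberg

theorem _root_.MeasureTheory.MemLp.comp_const_smul {V G : Type*} [NormedAddCommGroup V]
    [NormedSpace ℝ V] [FiniteDimensional ℝ V] [MeasurableSpace V] [BorelSpace V]
    [NormedAddCommGroup G] {μ : Measure V} [μ.IsAddHaarMeasure] {p : ENNReal} {f : V → G}
    (hf : MemLp f p μ) {r : ℝ} (hr : r ≠ 0) : MemLp (fun x => f (r • x)) p μ := by
  have hmap := Measure.map_addHaar_smul μ hr
  refine MemLp.comp_of_map (f := fun x : V => r • x) (g := f) ?_ (by fun_prop)
  rw [hmap]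
  exact hf.smul_measure ENNReal.ofReal_ne_top

theorem _root_.MeasureTheory.MemLp.comp_const_sub {V G : Type*} [NormedAddCommGroup V]
    [InnerProductSpace ℝ V] [FiniteDimensional ℝ V] [MeasurableSpace V] [BorelSpace V]
    [NormedAddCommGroup G] {p : ENNReal} {f : V → G} (hf : MemLp f p volume) (a : V) :
    MemLp (fun z => f (a - z)) p volume := by
  simp_rw [sub_eq_add_neg]
  exact hf.comp_measurePreserving ((measurePreserving_add_left (volume : Measure V) a).comp
    (LinearIsometryEquiv.neg ℝ).measurePreserving)

variable {n : ℕ}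

theorem finrank_R2 : Module.finrank ℝ (R2 n) = 2 * n := by
  rw [(WithLp.linearEquiv 2 ℝ (E n × E n)).finrank_eq, Module.finrank_prod,
    finrank_euclideanSpace_fin, two_mul]

theorem memLp_l2Fourier (f : R2 n → ℂ) : MemLp (l2Fourier f) 2 volume := by
  unfold l2Fourier
  split_ifs with hf
  · exact ((Lp.memLp (𝓕 (hf.toLp f))).comp_const_smul (by positivity)).const_mul _
  · exact MemLp.zero

theorem gau_mul_cexp (b c : ℝ) (α β w z : R2 n) :
    gau b c α β z * Complex.exp (Complex.I * (⟪w, z⟫_ℝ : ℝ)) = gau b c α (β + w) z := by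
  rw [gau, gau, ← Complex.exp_add, inner_add_left]
  push_cast
  ring_nf

/-- Dilation by 2π converts the kernel e^{-2πi w·z} into e^{-i w·z}; its Jacobian on `ℝ²ⁿ` is the
factor in front. -/
theorem fourier_gau_two_pi_smul (b c : ℝ) (α β z : R2 n) :
    𝓕 (fun y => gau b c α β ((2 * π) • y)) z =
      ((2 * π : ℝ) : ℂ)⁻¹ ^ (2 * n) * ∫ w, gau b c α (β - z) w := by
  rw [Real.fourier_eq']
  have h : ∀ y : R2 n, Complex.exp (((-2 * π * ⟪y, z⟫_ℝ : ℝ) : ℂ) * Complex.I) •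
      gau b c α β ((2 * π) • y) = gau b c α (β - z) ((2 * π) • y) := fun y => by
    rw [sub_eq_add_neg, ← gau_mul_cexp, smul_eq_mul, mul_comm, inner_smul_right, inner_neg_left,
      real_inner_comm]
    congr 2
    push_cast
    ring
  simp_rw [h]
  rw [Measure.integral_comp_smul, finrank_R2, Complex.real_smul, abs_of_pos (by positivity)]
  push_cast
  rw [inv_pow]

theorem exists_integral_gau_sub {b c : ℝ} (hb : 0 < b) (hc : 0 < c) (α β : R2 n) :
    ∃ (C : ℂ) (α' β' : R2 n), ∀ z,
      ∫ w, gau b c α (β - z) w = C * gau (1 / (4 * b)) (1 / (4 * c)) α' β' z := by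
  refine ⟨((√(π / b) ^ n * √(π / c) ^ n : ℝ) : ℂ) *
    Complex.exp ((((‖α.fst‖ ^ 2 - ‖β.fst‖ ^ 2) / (4 * b) +
        (‖α.snd‖ ^ 2 - ‖β.snd‖ ^ 2) / (4 * c) : ℝ) : ℂ) +
      Complex.I * (⟪α.fst, β.fst⟫_ℝ / (2 * b) + ⟪α.snd, β.snd⟫_ℝ / (2 * c) : ℝ)),
    WithLp.toLp 2 ((1 / (2 * b)) • β.fst, (1 / (2 * c)) • β.snd),
    WithLp.toLp 2 (-((1 / (2 * b)) • α.fst), -((1 / (2 * c)) • α.snd)), fun z => ?_⟩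
  rw [integral_gau hb hc, gau, inner_R2, inner_R2, mul_assoc, ← Complex.exp_add]
  congr 2
  simp only [WithLp.sub_fst, WithLp.sub_snd, WithLp.toLp_fst, WithLp.toLp_snd, inner_smul_left,
    inner_neg_left, norm_sub_sq_real, inner_sub_right, conj_trivial]
  have hb' : (b : ℂ) ≠ 0 := by exact_mod_cast hb.ne'
  have hc' : (c : ℂ) ≠ 0 := by exact_mod_cast hc.ne'
  push_cast
  field_simp
  ring

/-- Parseval for Gaussian test functions. Together with membership in L², this is all that is ever
used about `l2Fourier`. -/
theorem integral_l2Fourier_mul_gau {f : R2 n → ℂ} (hf : MemLp f 2 volume) {b c : ℝ} (hb : 0 < b)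
    (hc : 0 < c) (α β : R2 n) :
    ∫ w, l2Fourier f w * gau b c α β w =
      ((2 * π : ℝ) : ℂ)⁻¹ ^ n * ∫ z, f z * ∫ w, gau b c α (β - z) w := by
  have h2π : (2 * π : ℝ) ≠ 0 := by positivity
  have h1 : ∫ w, l2Fourier f w * gau b c α β w =
      ((2 * π : ℝ) : ℂ) ^ n * ∫ y, (𝓕 (hf.toLp f) : Lp ℂ 2 (volume : Measure (R2 n))) y *
        gau b c α β ((2 * π) • y) := by
    have h := Measure.integral_comp_smul (volume : Measure (R2 n))
      (fun y => (𝓕 (hf.toLp f) : Lp ℂ 2 (volume : Measure (R2 n))) y *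
        gau b c α β ((2 * π) • y)) (2 * π)⁻¹
    simp_rw [smul_inv_smul₀ h2π] at h
    rw [finrank_R2, inv_pow, inv_inv, abs_of_pos (by positivity), Complex.real_smul] at h
    simp only [l2Fourier, dif_pos hf, mul_assoc]
    rw [integral_const_mul, h, ← mul_assoc]
    congr 1
    have : ((2 * π : ℝ) : ℂ) ≠ 0 := by exact_mod_cast h2π
    push_cast at this ⊢
    rw [two_mul n, pow_add, inv_pow, inv_mul_cancel_left₀ (pow_ne_zero n this)]
  have hI : Integrable fun y : R2 n => gau b c α β ((2 * π) • y) :=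
    (integrable_gau hb hc α β).comp_smul h2π
  have hM : MemLp (fun y : R2 n => gau b c α β ((2 * π) • y)) 2 volume :=
    (memLp_gau hb hc α β).comp_const_smul h2π
  have hF : MemLp (𝓕 fun y : R2 n => gau b c α β ((2 * π) • y)) 2 volume := by
    obtain ⟨C, α', β', h⟩ := exists_integral_gau_sub hb hc α β
    rw [funext fun z => (fourier_gau_two_pi_smul b c α β z).trans (by rw [h z])]
    exact ((memLp_gau (by positivity) (by positivity) α' β').const_mul _).const_mul _
  rw [h1, integral_Lp_fourier_mul_eq hI hM hF]
  have h3 : ∀ᵐ z, (hf.toLp f) z * 𝓕 (fun y : R2 n => gau b c α β ((2 * π) • y)) z =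
      ((2 * π : ℝ) : ℂ)⁻¹ ^ (2 * n) * (f z * ∫ w, gau b c α (β - z) w) := by
    filter_upwards [hf.coeFn_toLp] with z hz
    rw [hz, fourier_gau_two_pi_smul]
    ring
  rw [integral_congr_ae h3, integral_const_mul, ← mul_assoc]
  congr 1
  have : ((2 * π : ℝ) : ℂ) ≠ 0 := by exact_mod_cast h2π
  rw [two_mul n, pow_add, ← mul_assoc, ← mul_pow, mul_inv_cancel₀ this, one_pow, one_mul]

end ReducedHeisenberg

/-! ### The kernels `ker`, `kerHat`, `kerMix`: bounds and partial Fourier transforms. -/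

namespace ReducedHeisenberg

/-- Domination by a tensor product of L² functions lets Cauchy–Schwarz act in each variable
separately. Every double integral below is justified in this way. -/
theorem integrable_mul_mul_of_norm_le {V : Type*} [NormedAddCommGroup V] [InnerProductSpace ℝ V]
    [FiniteDimensional ℝ V] [MeasurableSpace V] [BorelSpace V] {F G u v : V → ℂ}
    (hF : MemLp F 2 volume) (hG : MemLp G 2 volume) (hu : MemLp u 2 volume)
    (hv : MemLp v 2 volume) {Φ : V × V → ℂ} (hΦ : Continuous Φ) {C : ℝ}
    (h : ∀ x y, ‖Φ (x, y)‖ ≤ C * (‖u x‖ * ‖v y‖)) :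
    Integrable fun x : V × V => F x.1 * G x.2 * Φ x := by
  have h1 : Integrable fun x : V × V => (F x.1 * u x.1) * (G x.2 * v x.2) :=
    (hF.integrable_mul hu).mul_prod (hG.integrable_mul hv)
  refine (h1.norm.const_mul C).mono' ?_ (Filter.Eventually.of_forall fun x => ?_)
  · exact (hF.aestronglyMeasurable.comp_fst.mul hG.aestronglyMeasurable.comp_snd).mul
      hΦ.aestronglyMeasurable
  · simp only [norm_mul]
    calc ‖F x.1‖ * ‖G x.2‖ * ‖Φ x‖ ≤ ‖F x.1‖ * ‖G x.2‖ * (C * (‖u x.1‖ * ‖v x.2‖)) := by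
          gcongr
          exact h x.1 x.2
      _ = _ := by ring

variable {n : ℕ}

/-- The form `(z, z') ↦ q · T p' - q' · T p`. -/
noncomputable def sform (T : E n →ₗ[ℝ] E n) (z z' : R2 n) : ℝ :=
  ⟪z.fst, T z'.snd⟫_ℝ - ⟪z'.fst, T z.snd⟫_ℝ

/-- The normalized reproducing kernel of the coherent states. -/
noncomputable def ker (T : E n →ₗ[ℝ] E n) (κ : ℝ) (z z' : R2 n) : ℂ :=
  Complex.exp (((-(‖z.fst - z'.fst‖ ^ 2 / (4 * κ)) - ‖z.snd - z'.snd‖ ^ 2 / 4 : ℝ) : ℂ) +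
    Complex.I * (sform T z z' / (2 * κ) : ℝ))

/-- The Fourier transform, up to a constant, of the cyclic triple product of the kernel `ker`. -/
noncomputable def kerHat (T : E n →ₗ[ℝ] E n) (κ : ℝ) (z z' : R2 n) : ℂ :=
  Complex.exp (((-(κ / 2 * (‖z.fst‖ ^ 2 + ‖z'.fst‖ ^ 2 + ⟪z.fst, z'.fst⟫_ℝ)) -
      1 / 2 * (‖z.snd‖ ^ 2 + ‖z'.snd‖ ^ 2 + ⟪z.snd, z'.snd⟫_ℝ) : ℝ) : ℂ) +
    Complex.I * (sform T z' z / 2 : ℝ))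

/-- The kernel obtained from `kerHat` by a Fourier transform in the first variable. -/
noncomputable def kerMix (T S : E n →ₗ[ℝ] E n) (κ : ℝ) (a z ζ : R2 n) : ℂ :=
  Complex.exp (((-(‖a.fst - z.fst‖ ^ 2 / (2 * κ)) - ‖a.snd - z.snd‖ ^ 2 / 2 : ℝ) : ℂ)) *
    gau (κ / 2) (1 / 2)
      (WithLp.toLp 2 (-((1 / 2 : ℝ) • T (a.snd - z.snd)), (1 / (2 * κ)) • S (a.fst - z.fst)))
      ((1 / 2 : ℝ) • (a + z)) ζ

theorem ofReal_add_I_mul_congr {r₁ r₂ r₃ r₄ i₁ i₂ i₃ : ℝ} (hr : r₁ + r₂ = r₃ + r₄)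
    (hi : i₁ + i₂ = i₃) :
    (r₁ : ℂ) + Complex.I * i₁ + (r₂ + Complex.I * i₂) = r₃ + (r₄ + Complex.I * i₃) := by
  have hr' := congrArg (fun x : ℝ => (x : ℂ)) hr
  have hi' := congrArg (fun x : ℝ => (x : ℂ)) hi
  push_cast at hr' hi'
  linear_combination hr' + Complex.I * hi'

theorem ofReal_add_I_mul_congr' {r₁ r₂ r₃ r₄ r₅ i₂ i₃ i₄ i₅ : ℝ} (hr : r₁ + r₂ = r₃ + r₄ + r₅)
    (hi : i₂ = i₃ + i₄ + i₅) :
    (r₁ : ℂ) + (r₂ + Complex.I * i₂) = r₃ + Complex.I * i₃ + (r₄ + Complex.I * i₄) +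
      (r₅ + Complex.I * i₅) := by
  have hr' := congrArg (fun x : ℝ => (x : ℂ)) hr
  have hi' := congrArg (fun x : ℝ => (x : ℂ)) hi
  push_cast at hr' hi'
  linear_combination hr' + Complex.I * hi'

section

variable {T S : E n →ₗ[ℝ] E n} {κ : ℝ}

theorem continuous_sform (T : E n →ₗ[ℝ] E n) : Continuous fun x : R2 n × R2 n => sform T x.1 x.2 := by
  have := T.continuous_of_finiteDimensional
  unfold sform
  fun_prop

theorem continuous_kerHat (T : E n →ₗ[ℝ] E n) (κ : ℝ) :
    Continuous fun x : R2 n × R2 n => kerHat T κ x.1 x.2 := by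
  have := (continuous_sform T).comp continuous_swap
  simp only [Function.comp_def, Prod.fst_swap, Prod.snd_swap] at this
  unfold kerHat
  fun_prop

theorem continuous_kerMix (T S : E n →ₗ[ℝ] E n) (κ : ℝ) (a : R2 n) :
    Continuous fun x : R2 n × R2 n => kerMix T S κ a x.1 x.2 := by
  have h1 := T.continuous_of_finiteDimensional
  have h2 := S.continuous_of_finiteDimensional
  unfold kerMix gau
  simp only [inner_R2, WithLp.toLp_fst, WithLp.toLp_snd]
  fun_prop

/-- From |x + y|² ≥ 0 one gets |x|² + |y|² + x·y ≥ (|x|² + |y|²)/2. -/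
theorem norm_kerHat_le (T : E n →ₗ[ℝ] E n) (hκ : 0 < κ) (z z' : R2 n) :
    ‖kerHat T κ z z'‖ ≤ 1 * (‖gau (κ / 4) (1 / 4) 0 0 z‖ * ‖gau (κ / 4) (1 / 4) 0 0 z'‖) := by
  rw [kerHat, Complex.norm_exp, Complex.add_re, Complex.ofReal_re, Complex.re_mul_ofReal,
    Complex.I_re, zero_mul, add_zero, one_mul, norm_gau, norm_gau, ← Real.exp_add, Real.exp_le_exp,
    inner_zero_left, inner_zero_left]
  have h1 := sq_nonneg ‖z.fst + z'.fst‖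
  have h2 := sq_nonneg ‖z.snd + z'.snd‖
  rw [norm_add_sq_real] at h1 h2
  have h3 := mul_nonneg hκ.le h1
  nlinarith

theorem norm_kerMix_le (hκ : 0 < κ) (hT : ∀ x, ‖T x‖ ^ 2 = κ * ‖x‖ ^ 2)
    (hTS : ∀ x y, ⟪T x, y⟫_ℝ = ⟪x, S y⟫_ℝ) (a z ζ : R2 n) :
    ‖kerMix T S κ a z ζ‖ ≤
      1 * (‖gau (1 / (4 * κ)) (1 / 4) 0 0 (a - z)‖ * ‖gau (κ / 4) (1 / 4) 0 0 ζ‖) := by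
  rw [kerMix, norm_mul, Complex.norm_exp, Complex.ofReal_re, one_mul, norm_gau, norm_gau, norm_gau,
    ← Real.exp_add, ← Real.exp_add, Real.exp_le_exp, inner_zero_left, inner_zero_left, inner_R2]
  simp only [WithLp.toLp_fst, WithLp.toLp_snd, WithLp.sub_fst, WithLp.sub_snd]
  generalize a.fst - z.fst = d
  generalize a.snd - z.snd = e
  -- These two squares contain exactly the cross terms of `kerMix`, so half of the Gaussian decay
  -- absorbs them and the other half is the claimed bound.
  have h1 : 0 ≤ ‖d - T ζ.snd‖ ^ 2 / (4 * κ) := by positivity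
  have h2' : 0 ≤ ‖T e + κ • ζ.fst‖ ^ 2 / (4 * κ) := by positivity
  have e1 : ‖d - T ζ.snd‖ ^ 2 / (4 * κ) =
      ‖d‖ ^ 2 / (4 * κ) - 1 / (2 * κ) * ⟪S d, ζ.snd⟫_ℝ + 1 / 4 * ‖ζ.snd‖ ^ 2 := by
    rw [norm_sub_sq_real, hT, real_inner_comm (T ζ.snd), hTS, real_inner_comm (S d)]
    field_simp
    ring
  have e2 : ‖T e + κ • ζ.fst‖ ^ 2 / (4 * κ) =
      1 / 4 * ‖e‖ ^ 2 + 1 / 2 * ⟪T e, ζ.fst⟫_ℝ + κ / 4 * ‖ζ.fst‖ ^ 2 := by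
    rw [norm_add_sq_real, hT, real_inner_smul_right, norm_smul, mul_pow, Real.norm_eq_abs, sq_abs]
    field_simp
    ring
  rw [e1] at h1
  rw [e2] at h2'
  simp only [real_inner_smul_left, inner_neg_left]
  have e3 : ‖d‖ ^ 2 / (2 * κ) = 2 * (‖d‖ ^ 2 / (4 * κ)) := by field_simp; ring
  have e4 : 1 / (4 * κ) * ‖d‖ ^ 2 = ‖d‖ ^ 2 / (4 * κ) := by ring
  rw [e3, e4]
  linarith

/-- The factor of `kerHat` that depends on the second variable only. -/
theorem kerHat_mul_cexp (hTS : ∀ x y, ⟪T x, y⟫_ℝ = ⟪x, S y⟫_ℝ) (a z ζ : R2 n) :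
    kerHat T κ z ζ * Complex.exp (Complex.I * (⟪a, z + ζ⟫_ℝ : ℝ)) =
      gau (κ / 2) (1 / 2) 0 a ζ * gau (κ / 2) (1 / 2)
        (WithLp.toLp 2 (-((κ / 2) • ζ.fst), -((1 / 2 : ℝ) • ζ.snd)))
        (a + WithLp.toLp 2 (-((1 / 2 : ℝ) • T ζ.snd), (1 / 2 : ℝ) • S ζ.fst)) z := by
  rw [kerHat, gau, gau, ← Complex.exp_add, ← Complex.exp_add, sform]
  congr 1
  simp only [inner_R2, WithLp.toLp_fst, WithLp.toLp_snd, inner_zero_left, real_inner_smul_left,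
    inner_neg_left, inner_add_left, inner_add_right]
  rw [real_inner_comm z.snd (S ζ.fst), ← hTS, real_inner_comm (T ζ.snd) z.fst,
    real_inner_comm (T z.snd) ζ.fst, real_inner_comm ζ.fst z.fst, real_inner_comm ζ.snd z.snd]
  push_cast
  ring

theorem sqrt_const (hκ : 0 < κ) (n : ℕ) :
    (√(π / (κ / 2)) ^ n * √(π / (1 / 2)) ^ n : ℝ) = (2 * π) ^ n * (√κ)⁻¹ ^ n := by
  rw [← mul_pow, ← mul_pow]
  congr 1
  have h : √(π / (κ / 2)) = √(2 * π) * (√κ)⁻¹ := by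
    rw [← Real.sqrt_inv, ← Real.sqrt_mul (by positivity)]
    congr 1
    field_simp
  have h' : √(π / (1 / 2)) = √(2 * π) := by
    congr 1
    ring
  rw [h, h', mul_right_comm, Real.mul_self_sqrt (by positivity)]

theorem integral_gau_kerHat (hκ : 0 < κ) (hT : ∀ x, ‖T x‖ ^ 2 = κ * ‖x‖ ^ 2)
    (hS : ∀ x, ‖S x‖ ^ 2 = κ * ‖x‖ ^ 2)
    (hTS : ∀ x y, ⟪T x, y⟫_ℝ = ⟪x, S y⟫_ℝ) (a z ζ : R2 n) :
    gau (κ / 2) (1 / 2) 0 a ζ * ∫ w, gau (κ / 2) (1 / 2)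
        (WithLp.toLp 2 (-((κ / 2) • ζ.fst), -((1 / 2 : ℝ) • ζ.snd)))
        (a + WithLp.toLp 2 (-((1 / 2 : ℝ) • T ζ.snd), (1 / 2 : ℝ) • S ζ.fst) - z) w =
      (((2 * π) ^ n * (√κ)⁻¹ ^ n : ℝ) : ℂ) * kerMix T S κ a z ζ := by
  obtain ⟨d, rfl⟩ : ∃ d, z = a - d := ⟨a - z, by abel⟩
  rw [integral_gau (by positivity) (by positivity), sqrt_const hκ, mul_left_comm]
  congr 1
  rw [kerMix, gau, gau, ← Complex.exp_add, ← Complex.exp_add]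
  congr 1
  rw [← WithLp.sub_fst, ← WithLp.sub_snd, add_sub_right_comm, sub_sub_cancel]
  refine ofReal_add_I_mul_congr ?_ ?_
  · simp only [inner_R2, WithLp.toLp_fst, WithLp.toLp_snd, WithLp.add_fst, WithLp.add_snd,
      inner_zero_left, real_inner_smul_left, inner_neg_left, real_inner_smul_right,
      inner_neg_right, norm_neg, norm_smul, mul_pow, norm_add_sq_real, hT, hS, Real.norm_eq_abs,
      sq_abs]
    simp only [real_inner_comm _ (S _), ← hTS]
    simp only [real_inner_comm _ (T _)]
    field_simp
    ring
  · simp only [inner_R2, WithLp.toLp_fst, WithLp.toLp_snd, WithLp.add_fst, WithLp.add_snd,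
      inner_add_right,
      inner_sub_left, inner_add_left, real_inner_smul_left, inner_neg_left,
      real_inner_smul_right, inner_neg_right]
    rw [← hTS]
    rw [real_inner_comm (T ζ.snd), real_inner_comm d.fst, real_inner_comm d.snd]
    field_simp
    ring

theorem integral_gau_kerMix (hκ : 0 < κ) (hT : ∀ x, ‖T x‖ ^ 2 = κ * ‖x‖ ^ 2)
    (hS : ∀ x, ‖S x‖ ^ 2 = κ * ‖x‖ ^ 2)
    (hTS : ∀ x y, ⟪T x, y⟫_ℝ = ⟪x, S y⟫_ℝ) (a z z' : R2 n) :
    Complex.exp (((-(‖a.fst - z.fst‖ ^ 2 / (2 * κ)) - ‖a.snd - z.snd‖ ^ 2 / 2 : ℝ) : ℂ)) *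
      ∫ w, gau (κ / 2) (1 / 2)
      (WithLp.toLp 2 (-((1 / 2 : ℝ) • T (a.snd - z.snd)), (1 / (2 * κ)) • S (a.fst - z.fst)))
      ((1 / 2 : ℝ) • (a + z) - z') w =
      (((2 * π) ^ n * (√κ)⁻¹ ^ n : ℝ) : ℂ) * (ker T κ a z * ker T κ z z' * ker T κ z' a) := by
  -- A single kernel is not translation invariant, but the cyclic product is: its three phases add
  -- up to that of `sform T x y`.
  obtain ⟨x, rfl⟩ : ∃ x, a = z' + x := ⟨a - z', by abel⟩
  obtain ⟨y, rfl⟩ : ∃ y, z = z' + y := ⟨z - z', by abel⟩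
  have h : (1 / 2 : ℝ) • (z' + x + (z' + y)) - z' = (1 / 2 : ℝ) • (x + y) := by
    module
  rw [h, integral_gau (by positivity) (by positivity), sqrt_const hκ, mul_left_comm]
  congr 1
  rw [ker, ker, ker, ← Complex.exp_add, ← Complex.exp_add, ← Complex.exp_add]
  congr 1
  simp only [WithLp.add_fst, WithLp.add_snd, add_sub_add_left_eq_sub, sub_add_cancel_left,
    add_sub_cancel_left, norm_neg]
  refine ofReal_add_I_mul_congr' ?_ ?_
  · simp only [WithLp.toLp_fst, WithLp.toLp_snd, WithLp.add_fst, WithLp.add_snd,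
      WithLp.smul_fst, WithLp.smul_snd, norm_neg, norm_smul, mul_pow, norm_add_sq_real,
      norm_sub_sq_real, hT, hS, Real.norm_eq_abs, sq_abs]
    field_simp
    ring
  · simp only [WithLp.toLp_fst, WithLp.toLp_snd, WithLp.add_fst, WithLp.add_snd, sform, map_add,
      WithLp.smul_fst, WithLp.smul_snd, map_sub, inner_add_right, inner_sub_left,
      inner_add_left, real_inner_smul_left, inner_neg_left, real_inner_smul_right]
    simp only [real_inner_comm _ (S _), ← hTS]
    simp only [real_inner_comm _ (T _)]
    field_simp
    ring

end

end ReducedHeisenberg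

/-! ### From the triple-product identity to an equation between Fourier transforms. -/

namespace ReducedHeisenberg

variable {n : ℕ} {T S : E n →ₗ[ℝ] E n} {κ : ℝ}

theorem integrable_mul_kerHat (hκ : 0 < κ) {f g : R2 n → ℂ} (hf : MemLp f 2 volume)
    (hg : MemLp g 2 volume) :
    Integrable fun x : R2 n × R2 n => f x.1 * g x.2 * kerHat T κ x.1 x.2 :=
  integrable_mul_mul_of_norm_le hf hg
    (memLp_gau (by positivity) (by positivity) 0 0)
    (memLp_gau (by positivity) (by positivity) 0 0) (continuous_kerHat T κ) (norm_kerHat_le T hκ)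

theorem integrable_mul_kerMix (hκ : 0 < κ) (hT : ∀ x, ‖T x‖ ^ 2 = κ * ‖x‖ ^ 2)
    (hTS : ∀ x y, ⟪T x, y⟫_ℝ = ⟪x, S y⟫_ℝ) {f g : R2 n → ℂ} (hf : MemLp f 2 volume)
    (hg : MemLp g 2 volume) (a : R2 n) :
    Integrable fun x : R2 n × R2 n => f x.1 * g x.2 * kerMix T S κ a x.1 x.2 :=
  integrable_mul_mul_of_norm_le hf hg
    ((memLp_gau (by positivity) (by positivity) 0 0).comp_const_sub a)
    (memLp_gau (by positivity) (by positivity) 0 0) (continuous_kerMix T S κ a)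
    (norm_kerMix_le hκ hT hTS a)

theorem two_pi_inv_pow_mul (n : ℕ) (r : ℝ) :
    ((2 * π : ℝ) : ℂ)⁻¹ ^ n * (((2 * π) ^ n * r : ℝ) : ℂ) = (r : ℂ) := by
  have : ((2 * π : ℝ) : ℂ) ≠ 0 := by exact_mod_cast Real.two_pi_pos.ne'
  rw [Complex.ofReal_mul ((2 * π) ^ n), Complex.ofReal_pow, ← mul_assoc, ← mul_pow, inv_mul_cancel₀ this,
    one_pow, one_mul]

theorem integral_l2Fourier_mul_kerHat (hκ : 0 < κ) (hT : ∀ x, ‖T x‖ ^ 2 = κ * ‖x‖ ^ 2)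
    (hS : ∀ x, ‖S x‖ ^ 2 = κ * ‖x‖ ^ 2) (hTS : ∀ x y, ⟪T x, y⟫_ℝ = ⟪x, S y⟫_ℝ) {f : R2 n → ℂ}
    (hf : MemLp f 2 volume) (a ζ : R2 n) :
    ∫ z, l2Fourier f z *
      (kerHat T κ z ζ * Complex.exp (Complex.I * (⟪a, z + ζ⟫_ℝ : ℝ))) =
    (((√κ)⁻¹ ^ n : ℝ) : ℂ) * ∫ z, f z * kerMix T S κ a z ζ := by
  simp_rw [kerHat_mul_cexp hTS, mul_left_comm _ (gau (κ / 2) (1 / 2) 0 a ζ)]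
  rw [integral_const_mul, integral_l2Fourier_mul_gau hf (by positivity) (by positivity),
    mul_left_comm, ← integral_const_mul]
  simp_rw [mul_left_comm (gau (κ / 2) (1 / 2) 0 a ζ), integral_gau_kerHat hκ hT hS hTS,
    mul_left_comm (f _)]
  rw [integral_const_mul, ← mul_assoc, two_pi_inv_pow_mul]

theorem integral_l2Fourier_mul_kerMix (hκ : 0 < κ) (hT : ∀ x, ‖T x‖ ^ 2 = κ * ‖x‖ ^ 2)
    (hS : ∀ x, ‖S x‖ ^ 2 = κ * ‖x‖ ^ 2) (hTS : ∀ x y, ⟪T x, y⟫_ℝ = ⟪x, S y⟫_ℝ) {g : R2 n → ℂ}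
    (hg : MemLp g 2 volume) (a z : R2 n) :
    ∫ ζ, l2Fourier g ζ * kerMix T S κ a z ζ =
    (((√κ)⁻¹ ^ n : ℝ) : ℂ) *
      ∫ z', g z' * (ker T κ a z * ker T κ z z' * ker T κ z' a) := by
  simp only [kerMix]
  simp_rw [mul_left_comm (l2Fourier g _)]
  rw [integral_const_mul, integral_l2Fourier_mul_gau hg (by positivity) (by positivity),
    mul_left_comm, ← integral_const_mul]
  simp_rw [mul_left_comm _ (g _), integral_gau_kerMix hκ hT hS hTS, mul_left_comm (g _)]
  rw [integral_const_mul, ← mul_assoc, two_pi_inv_pow_mul]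

/-- The Fourier transform in both variables of the triple product of kernels. -/
theorem integral_integral_kerHat (hκ : 0 < κ) (hT : ∀ x, ‖T x‖ ^ 2 = κ * ‖x‖ ^ 2)
    (hS : ∀ x, ‖S x‖ ^ 2 = κ * ‖x‖ ^ 2) (hTS : ∀ x y, ⟪T x, y⟫_ℝ = ⟪x, S y⟫_ℝ)
    {f g : R2 n → ℂ} (hf : MemLp f 2 volume) (hg : MemLp g 2 volume) (a : R2 n) :
    ∫ ζ, l2Fourier g ζ * ∫ z, l2Fourier f z *
      (kerHat T κ z ζ * Complex.exp (Complex.I * (⟪a, z + ζ⟫_ℝ : ℝ))) =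
    ((κ⁻¹ ^ n : ℝ) : ℂ) * ∫ z, f z * ∫ z', g z' *
      (ker T κ a z * ker T κ z z' * ker T κ z' a) := by
  simp_rw [integral_l2Fourier_mul_kerHat hκ hT hS hTS hf, mul_left_comm (l2Fourier g _)]
  rw [integral_const_mul]
  -- Only one variable has been transformed so far; Fubini for the mixed kernel gives access to the
  -- other. Each transform contributes a factor κ^{-n/2}.
  have h := integral_integral_swap (f := fun z ζ => f z * l2Fourier g ζ * kerMix T S κ a z ζ)
    (integrable_mul_kerMix hκ hT hTS hf (memLp_l2Fourier g) a)
  have h1 : ∀ ζ, l2Fourier g ζ * ∫ z, f z * kerMix T S κ a z ζ =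
      ∫ z, f z * l2Fourier g ζ * kerMix T S κ a z ζ := fun ζ => by
    rw [← integral_const_mul]
    exact integral_congr_ae (Filter.Eventually.of_forall fun z => by ring)
  simp_rw [h1]
  rw [← h]
  simp_rw [mul_assoc, integral_const_mul, integral_l2Fourier_mul_kerMix hκ hT hS hTS hg,
    mul_left_comm (f _)]
  rw [integral_const_mul, ← mul_assoc, ← Complex.ofReal_mul, ← mul_pow, ← mul_inv,
    Real.mul_self_sqrt hκ.le]
  simp only [mul_assoc]

/-- The shear (w, ζ) ↦ (w - ζ, ζ) preserves Lebesgue measure. -/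
theorem integrable_shear (hκ : 0 < κ) {f g : R2 n → ℂ} (hf : MemLp f 2 volume)
    (hg : MemLp g 2 volume) :
    Integrable fun x : R2 n × R2 n => f (x.1 - x.2) * g x.2 * kerHat T κ (x.1 - x.2) x.2 :=
  (measurePreserving_sub_prod (volume : Measure (R2 n)) volume).integrable_comp_of_integrable
    (integrable_mul_kerHat (T := T) hκ hf hg)

theorem integral_cexp_mul_integral_shear (hκ : 0 < κ) {f g : R2 n → ℂ} (hf : MemLp f 2 volume)
    (hg : MemLp g 2 volume) (a : R2 n) :
    ∫ w, Complex.exp (Complex.I * (⟪a, w⟫_ℝ : ℝ)) *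
      ∫ ζ, f (w - ζ) * g ζ * kerHat T κ (w - ζ) ζ =
    ∫ ζ, g ζ * ∫ z, f z * (kerHat T κ z ζ * Complex.exp (Complex.I * (⟪a, z + ζ⟫_ℝ : ℝ))) := by
  have hI : Integrable fun x : R2 n × R2 n => Complex.exp (Complex.I * (⟪a, x.1⟫_ℝ : ℝ)) *
      (f (x.1 - x.2) * g x.2 * kerHat T κ (x.1 - x.2) x.2) := by
    refine (integrable_shear (T := T) hκ hf hg).bdd_mul (c := 1) (by fun_prop) ?_
    refine Filter.Eventually.of_forall fun x => ?_
    rw [mul_comm, Complex.norm_exp_ofReal_mul_I]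
  have h := integral_integral_swap (f := fun w ζ => Complex.exp (Complex.I * (⟪a, w⟫_ℝ : ℝ)) *
      (f (w - ζ) * g ζ * kerHat T κ (w - ζ) ζ)) hI
  simp_rw [integral_const_mul] at h
  rw [h]
  refine integral_congr_ae (Filter.Eventually.of_forall fun ζ => ?_)
  simp only
  rw [← integral_const_mul, ← integral_add_right_eq_self _ ζ]
  refine integral_congr_ae (Filter.Eventually.of_forall fun z => ?_)
  simp only [add_sub_cancel_right]
  ring

/-- The product of the Fourier transform of the Gaussian `‖ker a ·‖²` and `l2Fourier h`. -/
theorem integral_cexp_mul_l2Fourier_mul_gau (hκ : 0 < κ) {h : R2 n → ℂ} (hh : MemLp h 2 volume)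
    (a : R2 n) :
    ∫ w, Complex.exp (Complex.I * (⟪a, w⟫_ℝ : ℝ)) *
      (l2Fourier h w * gau (κ / 2) (1 / 2) 0 0 w) =
    (((√κ)⁻¹ ^ n : ℝ) : ℂ) * ∫ z, h z * (ker T κ a z * ker T κ z a) := by
  simp_rw [mul_left_comm (Complex.exp _), mul_comm (Complex.exp _), gau_mul_cexp]
  rw [integral_l2Fourier_mul_gau hh (by positivity) (by positivity)]
  have key : ∀ z, ∫ w, gau (κ / 2) (1 / 2) 0 (0 + a - z) w =
      (((2 * π) ^ n * (√κ)⁻¹ ^ n : ℝ) : ℂ) * (ker T κ a z * ker T κ z a) := fun z => by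
    rw [integral_gau (by positivity) (by positivity), sqrt_const hκ]
    congr 1
    rw [ker, ker, ← Complex.exp_add]
    congr 1
    simp only [sform, zero_add, WithLp.sub_fst, WithLp.sub_snd, WithLp.zero_fst, WithLp.zero_snd,
      norm_zero, inner_zero_left, norm_sub_rev z.fst, norm_sub_rev z.snd]
    have hκ' : (κ : ℂ) ≠ 0 := by exact_mod_cast hκ.ne'
    push_cast
    field_simp
    ring
  simp_rw [key, mul_left_comm (h _)]
  rw [integral_const_mul, ← mul_assoc, two_pi_inv_pow_mul]

/-- Both sides are integrable, and `heq` at the point a says that their Fourier transforms agree at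
-a/(2π). Since a is arbitrary, injectivity applies. -/
theorem l2Fourier_mul_gau_ae_eq (hκ : 0 < κ) (hT : ∀ x, ‖T x‖ ^ 2 = κ * ‖x‖ ^ 2)
    (hS : ∀ x, ‖S x‖ ^ 2 = κ * ‖x‖ ^ 2) (hTS : ∀ x y, ⟪T x, y⟫_ℝ = ⟪x, S y⟫_ℝ)
    {f g h : R2 n → ℂ} (hf : MemLp f 2 volume) (hg : MemLp g 2 volume) (hh : MemLp h 2 volume)
    (heq : ∀ a, ∫ z, h z * (ker T κ a z * ker T κ z a) =
      ((2 * π : ℝ) : ℂ)⁻¹ ^ n * (((√κ)⁻¹ ^ n : ℝ) : ℂ) * ∫ z, f z * ∫ z', g z' *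
        (ker T κ a z * ker T κ z z' * ker T κ z' a)) :
    (fun w => l2Fourier h w * gau (κ / 2) (1 / 2) 0 0 w) =ᵐ[volume] fun w =>
      ((2 * π : ℝ) : ℂ)⁻¹ ^ n *
        ∫ ζ, l2Fourier f (w - ζ) * l2Fourier g ζ * kerHat T κ (w - ζ) ζ := by
  refine ae_eq_of_fourier_eq ?_ ?_ ?_
  · exact (memLp_l2Fourier h).integrable_mul (memLp_gau (by positivity) (by positivity) 0 0)
  · exact (integrable_shear (T := T) hκ (memLp_l2Fourier f)
      (memLp_l2Fourier g)).integral_prod_left.const_mul _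
  · ext v
    rw [Real.fourier_eq', Real.fourier_eq']
    have hexp : ∀ w : R2 n, Complex.exp (((-2 * π * ⟪w, v⟫_ℝ : ℝ) : ℂ) * Complex.I) =
        Complex.exp (Complex.I * (⟪(-2 * π) • v, w⟫_ℝ : ℝ)) := fun w => by
      rw [real_inner_smul_left, real_inner_comm, mul_comm]
    simp_rw [hexp, smul_eq_mul]
    generalize (-2 * π) • v = a
    rw [integral_cexp_mul_l2Fourier_mul_gau (T := T) hκ hh, heq]
    simp_rw [mul_left_comm (Complex.exp _)]
    rw [integral_const_mul, integral_cexp_mul_integral_shear hκ (memLp_l2Fourier f)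
      (memLp_l2Fourier g), integral_integral_kerHat hκ hT hS hTS hf hg, mul_left_comm]
    simp only [← mul_assoc]
    congr 1
    rw [mul_assoc, ← Complex.ofReal_mul, ← mul_pow, ← mul_inv, Real.mul_self_sqrt hκ.le]

end ReducedHeisenberg

/-! ### Coherent states, removal of the torus variable, and overlaps. -/

namespace ReducedHeisenberg

variable {m n : ℕ}

theorem norm_torusChar (k : Fin m → ℤ) (t : Fin m → AddCircle (2 * π)) : ‖torusChar k t‖ = 1 := by
  rw [torusChar, norm_prod]
  exact Finset.prod_eq_one fun j _ => Circle.norm_coe _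

theorem torusChar_zero (k : Fin m → ℤ) : torusChar k 0 = 1 := by
  simp [torusChar]

variable (B : Fin m → Matrix (Fin n) (Fin n) ℝ) (k : Fin m → ℤ)

/-- The coherent state `π_k(z, 0) φ` of the Gaussian wavelet `φ`. -/
noncomputable def coh (z : R2 n) : L2 n := rep B k (z, 0) (gaussWavelet n)

theorem coeFn_rep (g : RedHeis m n) (f : L2 n) : rep B k g f =ᵐ[volume] repFun B k g f :=
  MemLp.coeFn_toLp _

theorem rep_eq_smul_coh (g : RedHeis m n) :
    rep B k g (gaussWavelet n) = torusChar k g.2 • coh B k g.1 := by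
  apply Lp.ext
  filter_upwards [coeFn_rep B k g (gaussWavelet n), coeFn_rep B k (g.1, 0) (gaussWavelet n),
    Lp.coeFn_smul (torusChar k g.2) (coh B k g.1)] with x h1 h2 h3
  rw [h1, h3, Pi.smul_apply, coh, h2, repFun, repFun, torusChar_zero, one_mul, smul_eq_mul,
    mul_assoc]

theorem coh_zero : coh B k 0 = gaussWavelet n := by
  apply Lp.ext
  filter_upwards [coeFn_rep B k (0, 0) (gaussWavelet n)] with x h1
  rw [coh, h1, repFun, torusChar_zero, WithLp.zero_fst, WithLp.zero_snd]
  simp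

theorem coeFn_coh (z : R2 n) : coh B k z =ᵐ[volume] repFun B k (z, 0) (gaussFun n) := by
  -- The wavelet is evaluated at x + p, so its null set must be translated.
  have h := (measurePreserving_add_right (volume : Measure (E n)) z.snd).quasiMeasurePreserving.ae
    ((memLp_gaussFun n).coeFn_toLp)
  filter_upwards [coeFn_rep B k (z, 0) (gaussWavelet n), h] with x h1 h2
  rw [coh, h1, repFun, repFun]
  simp only
  rw [← h2, gaussWavelet]

/-- The unimodular central character occurs once conjugated and once not, and cancels. The torus
then enters `locOp` only through its mass, which also cancels against the admissibility constant. -/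
theorem inner_smul_smul_coh (g : RedHeis m n) (c : ℂ) (f : L2 n) :
    (c * ⟪rep B k g (gaussWavelet n), f⟫_ℂ) • rep B k g (gaussWavelet n) =
      (c * ⟪coh B k g.1, f⟫_ℂ) • coh B k g.1 := by
  rw [rep_eq_smul_coh, inner_smul_left, smul_smul]
  congr 1
  have h : (starRingEnd ℂ) (torusChar k g.2) * torusChar k g.2 = 1 := by
    rw [Complex.conj_mul', norm_torusChar]
    simp
  linear_combination (c * ⟪coh B k g.1, f⟫_ℂ) * h

/-- The total mass of the torus. -/
noncomputable def torusMass (m : ℕ) : ℝ :=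
  (volume : Measure (Fin m → AddCircle (2 * π))).real Set.univ

theorem torusMass_ne_zero (m : ℕ) : torusMass m ≠ 0 := by
  rw [torusMass, measureReal_def]
  refine (ENNReal.toReal_pos ?_ (measure_ne_top _ _)).ne'
  rw [volume_pi, Measure.pi_univ]
  simp [AddCircle.measure_univ, Real.pi_pos]

theorem integral_redHeis {X : Type*} [NormedAddCommGroup X] [NormedSpace ℝ X]
    (f : R2 n → X) : ∫ g : RedHeis m n, f g.1 = torusMass m • ∫ z, f z :=
  integral_fun_fst f

theorem locOp_gaussWavelet (F : R2 n → ℂ) (f : L2 n) :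
    locOp B k (gaussWavelet n) F f =
      ((torusMass m / admissibilityConst B k (gaussWavelet n) : ℝ) : ℂ) •
        ∫ z, (F z * ⟪coh B k z, f⟫_ℂ) • coh B k z := by
  rw [locOp, locOpG]
  simp_rw [inner_smul_smul_coh]
  rw [integral_redHeis fun z => (F z * ⟪coh B k z, f⟫_ℂ) • coh B k z,
    RCLike.real_smul_eq_coe_smul (K := ℂ) (torusMass m),
    smul_smul]
  congr 1
  rw [Complex.ofReal_div, div_eq_mul_inv, mul_comm]
  rfl

/-- The normalized inner products of the coherent states. -/
noncomputable def cohKer (T : E n →ₗ[ℝ] E n) (κ : ℝ) (z z' : R2 n) : ℂ :=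
  Complex.exp (((-(κ * ‖z.fst - z'.fst‖ ^ 2 / 4) - ‖z.snd - z'.snd‖ ^ 2 / 4 : ℝ) : ℂ) +
    Complex.I * (sform T z z' / 2 : ℝ))

variable {B k} {S : E n →ₗ[ℝ] E n} {κ : ℝ}

/-- The overlap is a Gaussian integral in x with real linear term -(p + p') and frequency S(q' - q).
The scaling of S turns the frequency into κ|q - q'|², and the parallelogram law turns the p-terms
into |p - p'|². -/
theorem inner_coh (hS : ∀ x, ‖S x‖ ^ 2 = κ * ‖x‖ ^ 2)
    (hTS : ∀ x y, ⟪Matrix.toEuclideanLin (Bk B k) x, y⟫_ℝ = ⟪x, S y⟫_ℝ) (z z' : R2 n) :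
    ⟪coh B k z, coh B k z'⟫_ℂ =
      ((√(2 * π) ^ n : ℝ) : ℂ) * cohKer (Matrix.toEuclideanLin (Bk B k)) κ z z' := by
  have h : ∀ᵐ x, ⟪coh B k z x, coh B k z' x⟫_ℂ = ((√2 ^ n : ℝ) : ℂ) * (Complex.exp
      (((-(‖z.snd‖ ^ 2 / 2) - ‖z'.snd‖ ^ 2 / 2 : ℝ) : ℂ) +
        Complex.I * (⟪S z'.fst, z'.snd⟫_ℝ / 2 - ⟪S z.fst, z.snd⟫_ℝ / 2 : ℝ)) *
      Complex.exp (((-(1 * ‖x‖ ^ 2) + ⟪-(z.snd + z'.snd), x⟫_ℝ : ℝ) : ℂ) +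
        Complex.I * (⟪S z'.fst - S z.fst, x⟫_ℝ : ℝ))) := by
    filter_upwards [coeFn_coh B k z, coeFn_coh B k z'] with x h1 h2
    have h2n : ((2 : ℝ) ^ ((n : ℝ) / 4)) * ((2 : ℝ) ^ ((n : ℝ) / 4)) = √2 ^ n := by
      rw [← Real.rpow_add two_pos, Real.sqrt_eq_rpow, ← Real.rpow_natCast,
        ← Real.rpow_mul two_pos.le]
      ring_nf
    rw [h1, h2, RCLike.inner_apply', ← h2n]
    simp only [repFun, torusChar_zero, one_mul, gaussFun, map_mul, Complex.conj_ofReal,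
      ← Complex.exp_conj, Complex.conj_I]
    push_cast
    rw [← Complex.exp_add]
    have aux : ∀ a b c d e f p : ℂ, a + c + (b + d) = e →
        Complex.exp a * (p * Complex.exp c) * (Complex.exp b * (p * Complex.exp d)) =
        p * p * Complex.exp e := by
      intro a b c d e f p he
      rw [← he]
      simp only [Complex.exp_add]
      ring
    refine aux _ _ _ _ _ 0 _ ?_
    have e1 : ∀ w : R2 n, ⟪w.fst, act (Bk B k) (x + (1 / 2 : ℝ) • w.snd)⟫_ℝ =
        ⟪S w.fst, x⟫_ℝ + ⟪S w.fst, w.snd⟫_ℝ / 2 := fun w => by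
      rw [real_inner_comm, hTS, real_inner_comm, inner_add_right, real_inner_smul_right]
      ring
    have e2 : ∀ w : R2 n, ‖x + w.snd‖ ^ 2 = ‖x‖ ^ 2 + 2 * ⟪w.snd, x⟫_ℝ + ‖w.snd‖ ^ 2 :=
      fun w => by rw [norm_add_sq_real, real_inner_comm]
    have e3 : ∀ w : R2 n, (‖x + w.snd‖ : ℂ) ^ 2 =
        ‖x‖ ^ 2 + 2 * (⟪w.snd, x⟫_ℝ : ℝ) + ‖w.snd‖ ^ 2 := fun w => by exact_mod_cast e2 w
    rw [e1, e1, e3, e3, inner_neg_left, inner_add_left, inner_sub_left]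
    push_cast
    ring
  rw [L2.inner_def, integral_congr_ae h, integral_const_mul, integral_const_mul,
    integral_gauss one_pos]
  have hc : √(2 * π) ^ n = √2 ^ n * √(π / 1) ^ n := by
    rw [← mul_pow, ← Real.sqrt_mul two_pos.le, div_one]
  rw [hc, cohKer, mul_left_comm (Complex.exp _), ← mul_assoc, ← Complex.ofReal_mul,
    ← Complex.exp_add]
  congr 2
  have hsf : sform (Matrix.toEuclideanLin (Bk B k)) z z' =
      ⟪S z.fst, z'.snd⟫_ℝ - ⟪S z'.fst, z.snd⟫_ℝ := by
    rw [sform, real_inner_comm, hTS, real_inner_comm (S z.fst),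
      real_inner_comm _ z'.fst, hTS, real_inner_comm (S z'.fst)]
  rw [hsf, ← hS, map_sub, norm_neg, norm_add_sq_real, norm_sub_sq_real, norm_sub_sq_real,
    norm_sub_sq_real, inner_neg_left, inner_sub_right, inner_add_left, inner_add_left,
    real_inner_comm (S z.fst) (S z'.fst), real_inner_comm (S z'.fst) z.snd,
    real_inner_comm (S z'.fst) z'.snd, real_inner_comm (S z.fst) z.snd,
    real_inner_comm (S z.fst) z'.snd]
  push_cast
  ring

end ReducedHeisenberg

/-! ### Matrix elements of localization operators between coherent states. -/

namespace ReducedHeisenberg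

variable {m n : ℕ} {T S : E n →ₗ[ℝ] E n} {κ : ℝ}

theorem continuous_cohKer (T : E n →ₗ[ℝ] E n) (κ : ℝ) :
    Continuous fun x : R2 n × R2 n => cohKer T κ x.1 x.2 := by
  have := continuous_sform T
  unfold cohKer
  fun_prop

theorem continuous_cohKer_left (T : E n →ₗ[ℝ] E n) (κ : ℝ) (a : R2 n) :
    Continuous fun z : R2 n => cohKer T κ z a := by
  have := T.continuous_of_finiteDimensional
  unfold cohKer sform
  fun_prop

theorem norm_cohKer (T : E n →ₗ[ℝ] E n) (κ : ℝ) (z z' : R2 n) :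
    ‖cohKer T κ z z'‖ =
      Real.exp (-(κ * ‖z.fst - z'.fst‖ ^ 2 / 4) - ‖z.snd - z'.snd‖ ^ 2 / 4) := by
  rw [cohKer, Complex.norm_exp, Complex.add_re, Complex.ofReal_re, Complex.re_mul_ofReal,
    Complex.I_re, zero_mul, add_zero]

theorem cohKer_self (T : E n →ₗ[ℝ] E n) (κ : ℝ) (z : R2 n) : cohKer T κ z z = 1 := by
  simp [cohKer, sform]

theorem norm_cohKer_eq_norm_gau (T : E n →ₗ[ℝ] E n) (κ : ℝ) (z a : R2 n) :
    ‖cohKer T κ z a‖ = ‖gau (κ / 4) (1 / 4) 0 0 (a - z)‖ := by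
  rw [norm_cohKer, norm_gau, inner_zero_left, WithLp.sub_fst, WithLp.sub_snd,
    norm_sub_rev z.fst, norm_sub_rev z.snd]
  ring_nf

/-- Decay in z - z' and z' - a is traded for separate decay in a - z and a - z' through |a - z|² ≤
2|a - z'|² + 2|z - z'|², applied to each component. -/
theorem norm_cohKer_mul_le (T : E n →ₗ[ℝ] E n) (hκ : 0 < κ) (a z z' : R2 n) :
    ‖cohKer T κ z z' * cohKer T κ z' a‖ ≤
      1 * (‖gau (κ / 16) (1 / 16) 0 0 (a - z)‖ * ‖gau (κ / 8) (1 / 8) 0 0 (a - z')‖) := by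
  have key : ∀ x y w : E n, ‖w - x‖ ^ 2 / 16 + ‖w - y‖ ^ 2 / 8 ≤
      ‖x - y‖ ^ 2 / 4 + ‖y - w‖ ^ 2 / 4 := fun x y w => by
    have h1 : w - x = (w - y) - (x - y) := by abel
    have h2 := sq_nonneg ‖(w - y) + (x - y)‖
    rw [h1, norm_sub_rev y w]
    rw [norm_add_sq_real] at h2
    rw [norm_sub_sq_real]
    nlinarith [sq_nonneg ‖w - y‖, sq_nonneg ‖x - y‖]
  rw [norm_mul, norm_cohKer, norm_cohKer, norm_gau, norm_gau, one_mul, ← Real.exp_add,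
    ← Real.exp_add, Real.exp_le_exp, inner_zero_left, inner_zero_left]
  have h1 := mul_le_mul_of_nonneg_left (key z.fst z'.fst a.fst) hκ.le
  have h2 := key z.snd z'.snd a.snd
  simp only [WithLp.sub_fst, WithLp.sub_snd]
  linarith

theorem integrable_mul_cohKer (T : E n →ₗ[ℝ] E n) (hκ : 0 < κ) {F : R2 n → ℂ}
    (hF : MemLp F 2 volume) (a : R2 n) : Integrable fun z => F z * cohKer T κ z a := by
  have h := hF.integrable_mul ((memLp_gau (b := κ / 4) (c := 1 / 4) (by positivity) (by positivity)
      0 0).comp_const_sub a)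
  have hc := continuous_cohKer_left T κ a
  refine h.mono (hF.aestronglyMeasurable.mul hc.aestronglyMeasurable)
    (Filter.Eventually.of_forall fun z => ?_)
  rw [norm_mul, norm_cohKer_eq_norm_gau, Pi.mul_apply, norm_mul]

theorem integrable_mul_mul_cohKer (T : E n →ₗ[ℝ] E n) (hκ : 0 < κ) {F G : R2 n → ℂ}
    (hF : MemLp F 2 volume) (hG : MemLp G 2 volume) (a : R2 n) :
    Integrable fun z => F z * ∫ z', G z' * (cohKer T κ z z' * cohKer T κ z' a) := by
  have hc : Continuous fun x : R2 n × R2 n => cohKer T κ x.1 x.2 * cohKer T κ x.2 a :=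
    (continuous_cohKer T κ).mul ((continuous_cohKer_left T κ a).comp continuous_snd)
  have h := (integrable_mul_mul_of_norm_le hF hG
    ((memLp_gau (b := κ / 16) (c := 1 / 16) (by positivity) (by positivity)
      0 0).comp_const_sub a)
    ((memLp_gau (b := κ / 8) (c := 1 / 8) (by positivity) (by positivity)
      0 0).comp_const_sub a)
    hc (norm_cohKer_mul_le T hκ a)).integral_prod_left
  simpa only [mul_assoc, integral_const_mul] using h

variable {B : Fin m → Matrix (Fin n) (Fin n) ℝ} {k : Fin m → ℤ}

theorem norm_sq_coh (hS : ∀ x, ‖S x‖ ^ 2 = κ * ‖x‖ ^ 2)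
    (hTS : ∀ x y, ⟪Matrix.toEuclideanLin (Bk B k) x, y⟫_ℝ = ⟪x, S y⟫_ℝ) (z : R2 n) :
    ‖coh B k z‖ ^ 2 = √(2 * π) ^ n := by
  have h := inner_coh hS hTS z z
  rw [cohKer_self, mul_one, inner_self_eq_norm_sq_to_K] at h
  refine Complex.ofReal_injective ?_
  rw [← h]
  push_cast
  rfl

/-- The distance between two states is a function of their overlap, which is continuous. This
supplies the strong measurability of the `L²`-valued integrands. -/
theorem continuous_coh (hS : ∀ x, ‖S x‖ ^ 2 = κ * ‖x‖ ^ 2)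
    (hTS : ∀ x y, ⟪Matrix.toEuclideanLin (Bk B k) x, y⟫_ℝ = ⟪x, S y⟫_ℝ) :
    Continuous (coh B k) := by
  rw [continuous_iff_continuousAt]
  intro z₀
  rw [ContinuousAt, tendsto_iff_norm_sub_tendsto_zero]
  have h : ∀ z, ‖coh B k z - coh B k z₀‖ = √(√(2 * π) ^ n + √(2 * π) ^ n -
      2 * (((√(2 * π) ^ n : ℝ) : ℂ) *
        cohKer (Matrix.toEuclideanLin (Bk B k)) κ z z₀).re) := fun z => by
    rw [← Real.sqrt_sq (norm_nonneg (coh B k z - coh B k z₀)), @norm_sub_sq ℂ,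
      norm_sq_coh hS hTS, norm_sq_coh hS hTS, inner_coh hS hTS]
    congr 1
    simp only [RCLike.re_eq_complex_re]
    ring
  have hc := continuous_cohKer_left (Matrix.toEuclideanLin (Bk B k)) κ z₀
  have hc' : Continuous fun z : R2 n => √(√(2 * π) ^ n + √(2 * π) ^ n -
      2 * (((√(2 * π) ^ n : ℝ) : ℂ) *
        cohKer (Matrix.toEuclideanLin (Bk B k)) κ z z₀).re) := by fun_prop
  simp_rw [h]
  convert hc'.tendsto z₀ using 2
  rw [cohKer_self, mul_one, Complex.ofReal_re, two_mul (√(2 * π) ^ n), sub_self, Real.sqrt_zero]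

theorem integrable_smul_coh (hS : ∀ x, ‖S x‖ ^ 2 = κ * ‖x‖ ^ 2)
    (hTS : ∀ x y, ⟪Matrix.toEuclideanLin (Bk B k) x, y⟫_ℝ = ⟪x, S y⟫_ℝ) {F : R2 n → ℂ}
    (hF : Integrable F) : Integrable fun z => F z • coh B k z := by
  refine (hF.norm.mul_const √(√(2 * π) ^ n)).mono'
    (hF.aestronglyMeasurable.smul (continuous_coh hS hTS).aestronglyMeasurable)
    (Filter.Eventually.of_forall fun z => ?_)
  rw [norm_smul, ← norm_sq_coh hS hTS z, Real.sqrt_sq (norm_nonneg _)]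

theorem admissibilityConst_gaussWavelet (hκ : 0 < κ) (hS : ∀ x, ‖S x‖ ^ 2 = κ * ‖x‖ ^ 2)
    (hTS : ∀ x y, ⟪Matrix.toEuclideanLin (Bk B k) x, y⟫_ℝ = ⟪x, S y⟫_ℝ) :
    admissibilityConst B k (gaussWavelet n) =
      torusMass m * (√(2 * π) ^ n * ((2 * π) ^ n * (√κ)⁻¹ ^ n)) := by
  have h : ∀ g : RedHeis m n, ‖⟪rep B k g (gaussWavelet n), gaussWavelet n⟫_ℂ‖ ^ 2 =
      (fun z => (√(2 * π) ^ n) ^ 2 * ‖gau (κ / 2) (1 / 2) 0 0 z‖) g.1 := fun g => by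
    rw [rep_eq_smul_coh, inner_smul_left, ← coh_zero B k, inner_coh hS hTS, norm_mul,
      RCLike.norm_conj, norm_torusChar, one_mul, norm_mul, norm_cohKer, Complex.norm_real,
      Real.norm_eq_abs, mul_pow, sq_abs, ← Real.exp_nat_mul]
    simp only [norm_gau]
    congr 2
    simp only [WithLp.zero_fst, WithLp.zero_snd, sub_zero, inner_zero_left]
    push_cast
    ring
  have h2 : ∫ z : R2 n, ‖gau (κ / 2) (1 / 2) 0 0 z‖ = (2 * π) ^ n * (√κ)⁻¹ ^ n := by
    rw [← sqrt_const hκ, ← Complex.ofReal_inj, ← integral_complex_ofReal]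
    have h3 : ∀ z : R2 n, ((‖gau (κ / 2) (1 / 2) 0 0 z‖ : ℝ) : ℂ) =
        gau (κ / 2) (1 / 2) 0 0 z := fun z => by
      rw [norm_gau, gau, inner_zero_left]
      simp
    simp_rw [h3]
    rw [integral_gau (by positivity) (by positivity)]
    simp
  rw [admissibilityConst]
  simp_rw [h]
  rw [integral_redHeis fun z : R2 n => (√(2 * π) ^ n) ^ 2 * ‖gau (κ / 2) (1 / 2) 0 0 z‖,
    integral_const_mul, h2, ← coh_zero B k, norm_sq_coh hS hTS, smul_eq_mul]
  have : √(2 * π) ^ n ≠ 0 := by positivity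
  field_simp

theorem inner_locOp_coh (hκ : 0 < κ) (hS : ∀ x, ‖S x‖ ^ 2 = κ * ‖x‖ ^ 2)
    (hTS : ∀ x y, ⟪Matrix.toEuclideanLin (Bk B k) x, y⟫_ℝ = ⟪x, S y⟫_ℝ) {F : R2 n → ℂ} {f : L2 n}
    (hF : Integrable fun z => F z * ⟪coh B k z, f⟫_ℂ) (b : R2 n) :
    ⟪coh B k b, locOp B k (gaussWavelet n) F f⟫_ℂ =
      ((((2 * π) ^ n * (√κ)⁻¹ ^ n)⁻¹ : ℝ) : ℂ) *
        ∫ z, F z * (⟪coh B k z, f⟫_ℂ * cohKer (Matrix.toEuclideanLin (Bk B k)) κ b z) := by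
  rw [locOp_gaussWavelet, inner_smul_right, ← integral_inner (integrable_smul_coh hS hTS hF)]
  simp_rw [inner_smul_right, inner_coh hS hTS, mul_left_comm _ ((√(2 * π) ^ n : ℝ) : ℂ)]
  rw [integral_const_mul, ← mul_assoc, ← Complex.ofReal_mul]
  congr 1
  · rw [admissibilityConst_gaussWavelet hκ hS hTS]
    have h1 : √(2 * π) ^ n ≠ 0 := by positivity
    have h2 := torusMass_ne_zero m
    congr 1
    field_simp
  · simp_rw [mul_assoc]

theorem integral_cohKer_eq_of_locOp_comp (hκ : 0 < κ) (hS : ∀ x, ‖S x‖ ^ 2 = κ * ‖x‖ ^ 2)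
    (hTS : ∀ x y, ⟪Matrix.toEuclideanLin (Bk B k) x, y⟫_ℝ = ⟪x, S y⟫_ℝ) {F G H : R2 n → ℂ}
    (hF : MemLp F 2 volume) (hG : MemLp G 2 volume) (hH : MemLp H 2 volume)
    (hprod : locOp B k (gaussWavelet n) H =
      locOp B k (gaussWavelet n) F ∘ locOp B k (gaussWavelet n) G)
    (hT : T = Matrix.toEuclideanLin (Bk B k)) (a : R2 n) :
    ∫ z, H z * (cohKer T κ a z * cohKer T κ z a) =
      ((((2 * π) ^ n * (√κ)⁻¹ ^ n)⁻¹ : ℝ) : ℂ) *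
      ∫ z, F z * ∫ z', G z' * (cohKer T κ a z * cohKer T κ z z' * cohKer T κ z' a) := by
  set N : ℂ := ((√(2 * π) ^ n : ℝ) : ℂ) with hN
  set D : ℂ := ((((2 * π) ^ n * (√κ)⁻¹ ^ n)⁻¹ : ℝ) : ℂ) with hD
  have hN0 : N ≠ 0 := by
    rw [hN, Complex.ofReal_ne_zero]
    positivity
  have hD0 : D ≠ 0 := by
    rw [hD, Complex.ofReal_ne_zero]
    positivity
  have h1 : ∀ {K : R2 n → ℂ}, MemLp K 2 volume →
      Integrable fun z => K z * ⟪coh B k z, coh B k a⟫_ℂ := fun {K} hK => by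
    simp_rw [inner_coh hS hTS, ← hT, mul_left_comm (K _)]
    exact (integrable_mul_cohKer T hκ hK a).const_mul _
  have h2 : ∀ {K : R2 n → ℂ}, MemLp K 2 volume → ∀ b,
      ⟪coh B k b, locOp B k (gaussWavelet n) K (coh B k a)⟫_ℂ =
        D * N * ∫ z, K z * (cohKer T κ b z * cohKer T κ z a) := fun {K} hK b => by
    rw [inner_locOp_coh hκ hS hTS (h1 hK), ← hT, mul_assoc, ← integral_const_mul (μ := volume) N]
    congr 1
    refine integral_congr_ae (Filter.Eventually.of_forall fun z => ?_)
    simp only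
    rw [inner_coh hS hTS, ← hT]
    ring
  -- Without this the Bochner integral defining L_F on the vector L_G(`coh B k a`) could be the
  -- default value 0.
  have h3 : Integrable fun z => F z *
      ⟪coh B k z, locOp B k (gaussWavelet n) G (coh B k a)⟫_ℂ := by
    simp_rw [h2 hG, mul_left_comm (F _)]
    exact (integrable_mul_mul_cohKer T hκ hF hG a).const_mul _
  -- The left side carries the constant D·N and the right side D²·N, so one factor D survives.
  have h4 := congrArg (fun u => ⟪coh B k a, u⟫_ℂ) (congrFun hprod (coh B k a))
  simp only [Function.comp_apply] at h4
  rw [h2 hH, inner_locOp_coh hκ hS hTS h3, ← hT, mul_assoc] at h4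
  replace h4 := mul_left_cancel₀ hD0 h4
  have h5 : ∀ z, F z * (⟪coh B k z, locOp B k (gaussWavelet n) G (coh B k a)⟫_ℂ *
      cohKer T κ a z) = D * N * (F z * ∫ z', G z' *
        (cohKer T κ a z * cohKer T κ z z' * cohKer T κ z' a)) := fun z => by
    rw [h2 hG]
    simp_rw [mul_assoc (cohKer T κ a z), mul_left_comm (G _) (cohKer T κ a z)]
    rw [integral_const_mul]
    ring
  simp_rw [h5] at h4
  rw [integral_const_mul, mul_comm D N, mul_assoc] at h4
  exact mul_left_cancel₀ hN0 h4

end ReducedHeisenberg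

/-! ### Algebra of B_k and the change of variables in F^k. -/

namespace ReducedHeisenberg

variable {m n : ℕ}

theorem normSqK_pos {k : Fin m → ℤ} (hk : k ≠ 0) : 0 < normSqK k := by
  obtain ⟨j, hj⟩ := Function.ne_iff.1 hk
  refine Finset.sum_pos' (fun i _ => sq_nonneg _) ⟨j, Finset.mem_univ j, ?_⟩
  have : (k j : ℝ) ≠ 0 := by exact_mod_cast hj
  positivity

theorem transpose_Bk_mul_Bk {B : Fin m → Matrix (Fin n) (Fin n) ℝ}
    (hB : ∀ j, B j ∈ Matrix.orthogonalGroup (Fin n) ℝ)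
    (hBB : ∀ i j, i ≠ j → (B i)⁻¹ * B j = -((B j)⁻¹ * B i)) (k : Fin m → ℤ) :
    (Bk B k).transpose * Bk B k = normSqK k • (1 : Matrix (Fin n) (Fin n) ℝ) := by
  have hinv : ∀ j, (B j)⁻¹ = (B j).transpose := fun j =>
    Matrix.inv_eq_left_inv ((Matrix.mem_orthogonalGroup_iff' _ _).1 (hB j))
  have h1 : (Bk B k).transpose * Bk B k =
      ∑ i, ∑ j, ((k i : ℝ) * k j) • ((B i).transpose * B j) := by
    simp only [Bk, Matrix.transpose_sum, Matrix.transpose_smul, Finset.sum_mul, Finset.mul_sum,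
      smul_mul_smul_comm]
    exact Finset.sum_comm
  -- Doubling pairs the (i, j) term with the (j, i) term. Off the diagonal the pair vanishes by
  -- anticommutation, and on the diagonal orthogonality gives 2kᵢ².
  have h2 : (Bk B k).transpose * Bk B k + (Bk B k).transpose * Bk B k =
      normSqK k • (1 : Matrix (Fin n) (Fin n) ℝ) + normSqK k • (1 : Matrix (Fin n) (Fin n) ℝ) := by
    calc _ = ∑ i, ∑ j, ((k i : ℝ) * k j) • ((B i).transpose * B j) +
          ∑ i, ∑ j, ((k i : ℝ) * k j) • ((B j).transpose * B i) := by
          rw [h1, Finset.sum_comm (f := fun i j => ((k i : ℝ) * k j) • ((B j).transpose * B i))]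
          simp only [mul_comm]
      _ = ∑ i, ∑ j, ((k i : ℝ) * k j) •
          ((B i).transpose * B j + (B j).transpose * B i) := by
          simp only [← Finset.sum_add_distrib, smul_add]
      _ = ∑ i, ((k i : ℝ) ^ 2 + (k i : ℝ) ^ 2) • (1 : Matrix (Fin n) (Fin n) ℝ) := by
          refine Finset.sum_congr rfl fun i _ => ?_
          rw [Finset.sum_eq_single i]
          · have h := (Matrix.mem_orthogonalGroup_iff' _ _).1 (hB i)
            rw [h, ← two_smul ℝ (1 : Matrix (Fin n) (Fin n) ℝ), smul_smul]
            ring_nf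
          · intro j _ hj
            rw [← hinv, ← hinv, hBB i j hj.symm, neg_add_cancel, smul_zero]
          · simp
      _ = _ := by rw [normSqK, ← add_smul, ← Finset.sum_add_distrib, Finset.sum_smul]
  rw [← two_smul ℝ, ← two_smul ℝ (normSqK k • (1 : Matrix (Fin n) (Fin n) ℝ))] at h2
  exact smul_right_injective _ (two_ne_zero' ℝ) h2

theorem mul_transpose_eq_smul_one {A : Matrix (Fin n) (Fin n) ℝ} {κ : ℝ} (hκ : κ ≠ 0)
    (h : A.transpose * A = κ • (1 : Matrix (Fin n) (Fin n) ℝ)) :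
    A * A.transpose = κ • (1 : Matrix (Fin n) (Fin n) ℝ) := by
  have h1 : (κ⁻¹ • A.transpose) * A = 1 := by
    rw [smul_mul_assoc, h, smul_smul, inv_mul_cancel₀ hκ, one_smul]
  have h2 := mul_eq_one_comm.1 h1
  rw [mul_smul_comm] at h2
  rw [← h2, smul_smul, mul_inv_cancel₀ hκ, one_smul]

theorem inner_toEuclideanLin (A : Matrix (Fin n) (Fin n) ℝ) (x y : E n) :
    ⟪Matrix.toEuclideanLin A x, y⟫_ℝ = ⟪x, Matrix.toEuclideanLin A.transpose y⟫_ℝ := by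
  rw [← Matrix.conjTranspose_eq_transpose_of_trivial,
    Matrix.toEuclideanLin_conjTranspose_eq_adjoint, LinearMap.adjoint_inner_right]

theorem toEuclideanLin_toEuclideanLin {A A' : Matrix (Fin n) (Fin n) ℝ} {κ : ℝ}
    (h : A * A' = κ • (1 : Matrix (Fin n) (Fin n) ℝ)) (x : E n) :
    Matrix.toEuclideanLin A (Matrix.toEuclideanLin A' x) = κ • x := by
  rw [Matrix.toLpLin_apply, Matrix.toLpLin_apply, Matrix.mulVec_mulVec, h,
    Matrix.smul_mulVec, Matrix.one_mulVec]
  rfl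

theorem norm_sq_toEuclideanLin {A : Matrix (Fin n) (Fin n) ℝ} {κ : ℝ}
    (h : A.transpose * A = κ • (1 : Matrix (Fin n) (Fin n) ℝ)) (x : E n) :
    ‖Matrix.toEuclideanLin A x‖ ^ 2 = κ * ‖x‖ ^ 2 := by
  rw [← real_inner_self_eq_norm_sq, inner_toEuclideanLin, toEuclideanLin_toEuclideanLin h,
    real_inner_smul_right, real_inner_self_eq_norm_sq]

section Twist

variable {T S : E n →ₗ[ℝ] E n} {κ : ℝ}

/-- The linear isometry `(q, p) ↦ κ^{-1/2} (T p, -S q)` of `ℝ²ⁿ`. -/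
noncomputable def twistIso (hκ : 0 < κ) (hT : ∀ x, ‖T x‖ ^ 2 = κ * ‖x‖ ^ 2)
    (hS : ∀ x, ‖S x‖ ^ 2 = κ * ‖x‖ ^ 2) : R2 n ≃ₗᵢ[ℝ] R2 n :=
  LinearIsometry.toLinearIsometryEquiv
    { toFun := fun z => WithLp.toLp 2 ((√κ)⁻¹ • T z.snd, -((√κ)⁻¹ • S z.fst))
      map_add' := fun x y => by
        refine WithLp.ofLp_injective 2 (Prod.ext ?_ ?_)
        · simp
        · simp [add_comm]
      map_smul' := fun c x => by
        refine WithLp.ofLp_injective 2 (Prod.ext ?_ ?_) <;> simp [smul_comm c]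
      norm_map' := fun z => by
        refine (sq_eq_sq₀ (norm_nonneg _) (norm_nonneg _)).1 ?_
        have h : (√κ) ^ 2 = κ := Real.sq_sqrt hκ.le
        change ‖WithLp.toLp 2 ((√κ)⁻¹ • T z.snd, -((√κ)⁻¹ • S z.fst))‖ ^ 2 = ‖z‖ ^ 2
        rw [WithLp.prod_norm_sq_eq_of_L2, WithLp.prod_norm_sq_eq_of_L2]
        simp only [WithLp.toLp_fst, WithLp.toLp_snd, norm_neg, norm_smul, mul_pow, hT, hS,
          Real.norm_eq_abs, sq_abs, inv_pow, h]
        field_simp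
        ring } rfl

/-- The linear map `(q, p) ↦ κ⁻¹ (T p, -S q)` of `ℝ²ⁿ`. -/
noncomputable def twistMap (T S : E n →ₗ[ℝ] E n) (κ : ℝ) (z : R2 n) : R2 n :=
  WithLp.toLp 2 (κ⁻¹ • T z.snd, -(κ⁻¹ • S z.fst))

theorem twistMap_eq_smul (hκ : 0 < κ) (hT : ∀ x, ‖T x‖ ^ 2 = κ * ‖x‖ ^ 2)
    (hS : ∀ x, ‖S x‖ ^ 2 = κ * ‖x‖ ^ 2) (z : R2 n) :
    twistMap T S κ z = (√κ)⁻¹ • twistIso hκ hT hS z := by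
  change _ = (√κ)⁻¹ • WithLp.toLp 2 ((√κ)⁻¹ • T z.snd, -((√κ)⁻¹ • S z.fst))
  have h : κ⁻¹ = (√κ)⁻¹ * (√κ)⁻¹ := by rw [← mul_inv, Real.mul_self_sqrt hκ.le]
  refine WithLp.ofLp_injective 2 (Prod.ext ?_ ?_) <;> simp [twistMap, h, smul_smul]

theorem memLp_comp_twistMap (hκ : 0 < κ) (hT : ∀ x, ‖T x‖ ^ 2 = κ * ‖x‖ ^ 2)
    (hS : ∀ x, ‖S x‖ ^ 2 = κ * ‖x‖ ^ 2) {F : R2 n → ℂ} (hF : MemLp F 2 volume) :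
    MemLp (fun z => F (twistMap T S κ z)) 2 volume := by
  simp_rw [twistMap_eq_smul hκ hT hS]
  exact (hF.comp_const_smul (r := (√κ)⁻¹) (by positivity)).comp_measurePreserving
    (twistIso hκ hT hS).measurePreserving

/-- The twist is an isometry followed by the dilation κ^{-1/2}, whose Jacobian in dimension 2n is
κ^{-n}. -/
theorem integral_comp_twistMap (hκ : 0 < κ) (hT : ∀ x, ‖T x‖ ^ 2 = κ * ‖x‖ ^ 2)
    (hS : ∀ x, ‖S x‖ ^ 2 = κ * ‖x‖ ^ 2) (F : R2 n → ℂ) :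
    ∫ z, F z = ((κ⁻¹ ^ n : ℝ) : ℂ) * ∫ z, F (twistMap T S κ z) := by
  simp_rw [twistMap_eq_smul hκ hT hS]
  have h := (twistIso hκ hT hS).measurePreserving.integral_comp
    (twistIso hκ hT hS).toHomeomorph.measurableEmbedding (fun y => F ((√κ)⁻¹ • y))
  rw [h, Measure.integral_comp_smul, finrank_R2, Complex.real_smul, ← mul_assoc,
    ← Complex.ofReal_mul, pow_mul, inv_pow (√κ), Real.sq_sqrt hκ.le, abs_of_pos (by positivity),
    mul_inv_cancel₀ (by positivity), Complex.ofReal_one, one_mul]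

/-- The twist exchanges the roles of q and p, changing the weights (κ, 1) into (1/κ, 1), and
multiplies the form `sform T` by 1/κ. -/
theorem cohKer_twistMap (hκ : 0 < κ) (hT : ∀ x, ‖T x‖ ^ 2 = κ * ‖x‖ ^ 2)
    (hS : ∀ x, ‖S x‖ ^ 2 = κ * ‖x‖ ^ 2) (hTS : ∀ x y, ⟪T x, y⟫_ℝ = ⟪x, S y⟫_ℝ)
    (hST : ∀ x, S (T x) = κ • x) (z z' : R2 n) :
    cohKer T κ (twistMap T S κ z) (twistMap T S κ z') = ker T κ z z' := by
  have h1 : ‖(κ⁻¹ • T z.snd - κ⁻¹ • T z'.snd)‖ ^ 2 = κ⁻¹ * ‖z.snd - z'.snd‖ ^ 2 := by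
    rw [← smul_sub, ← map_sub, norm_smul, mul_pow, hT, Real.norm_eq_abs, sq_abs]
    field_simp
  have h2 : ‖(-(κ⁻¹ • S z.fst) - -(κ⁻¹ • S z'.fst))‖ ^ 2 = κ⁻¹ * ‖z.fst - z'.fst‖ ^ 2 := by
    rw [← norm_neg, neg_sub_neg, neg_sub, ← smul_sub, ← map_sub, norm_smul, mul_pow, hS,
      Real.norm_eq_abs, sq_abs]
    field_simp
  have h3 : sform T (twistMap T S κ z) (twistMap T S κ z') = sform T z z' / κ := by
    have e : ∀ x y, ⟪T x, T (S y)⟫_ℝ = κ * ⟪y, T x⟫_ℝ := fun x y => by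
      rw [hTS, hST, real_inner_smul_right, ← hTS, real_inner_comm]
    simp only [sform, twistMap, WithLp.toLp_fst, WithLp.toLp_snd, map_neg, map_smul,
      inner_neg_right, real_inner_smul_left, real_inner_smul_right, e]
    field_simp
    ring
  rw [cohKer, ker, h3]
  simp only [twistMap, WithLp.toLp_fst, WithLp.toLp_snd]
  rw [h1, h2]
  have hκ' : (κ : ℂ) ≠ 0 := by exact_mod_cast hκ.ne'
  congr 1
  push_cast
  field_simp
  ring

end Twist

end ReducedHeisenberg

/-! ### Identification with the new convolution, and the conclusion. -/

namespace ReducedHeisenberg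

variable {m n : ℕ}

theorem sum_mul_bracket (B : Fin m → Matrix (Fin n) (Fin n) ℝ) (k : Fin m → ℤ) (w z : R2 n) :
    ∑ j, (k j : ℝ) * bracket B w z j = sform (Matrix.toEuclideanLin (Bk B k)) z w := by
  have h : ∀ x y : E n, ⟪x, Matrix.toEuclideanLin (Bk B k) y⟫_ℝ =
      ∑ j, (k j : ℝ) * ⟪x, act (B j) y⟫_ℝ := fun x y => by
    rw [Bk, map_sum, LinearMap.sum_apply, inner_sum]
    refine Finset.sum_congr rfl fun j _ => ?_
    rw [map_smul, LinearMap.smul_apply, real_inner_smul_right]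
  simp only [sform, h, bracket, mul_sub, Finset.sum_sub_distrib]

/-- In each component |w - z|² + |z|² + (w - z)·z = |w|² - w·z + |z|². The phase depends only on z
and w because `sform` vanishes on the diagonal. -/
theorem gau_mul_newConvIntegrand (B : Fin m → Matrix (Fin n) (Fin n) ℝ) (k : Fin m → ℤ)
    (F G : R2 n → ℂ) (w z : R2 n) :
    gau (normSqK k / 2) (1 / 2) 0 0 w * newConvIntegrand B k F G w z =
      F (w - z) * G z * kerHat (Matrix.toEuclideanLin (Bk B k)) (normSqK k) (w - z) z := by
  have h : kerHat (Matrix.toEuclideanLin (Bk B k)) (normSqK k) (w - z) z =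
      gau (normSqK k / 2) (1 / 2) 0 0 w *
        (Complex.exp ((-(‖z.snd‖ ^ 2 / 2) - normSqK k * ‖z.fst‖ ^ 2 / 2 : ℝ) : ℂ) *
        Complex.exp ((⟪w.snd, z.snd⟫_ℝ / 2 + normSqK k * ⟪w.fst, z.fst⟫_ℝ / 2 : ℝ) : ℂ) *
        Complex.exp (Complex.I / 2 * ((∑ j, (k j : ℝ) * bracket B w z j : ℝ) : ℂ))) := by
    rw [sum_mul_bracket, kerHat, gau, ← Complex.exp_add, ← Complex.exp_add, ← Complex.exp_add]
    congr 1
    simp only [sform, WithLp.sub_fst, WithLp.sub_snd, map_sub, inner_sub_left, inner_sub_right,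
      inner_zero_left, norm_sub_sq_real, real_inner_self_eq_norm_sq]
    push_cast
    ring
  rw [h, newConvIntegrand, Complex.ofReal_exp, Complex.ofReal_exp]
  ring

/-- After multiplication by a Gaussian constant in z, the weight is `kerHat`, bounded by 1.
Cauchy–Schwarz then gives convergence at every w, whereas Fubini would only give almost every w. -/
theorem integrable_newConvIntegrand (B : Fin m → Matrix (Fin n) (Fin n) ℝ) {k : Fin m → ℤ}
    (hk : k ≠ 0) {F G : R2 n → ℂ} (hF : MemLp F 2 volume) (hG : MemLp G 2 volume) (w : R2 n) :
    Integrable (newConvIntegrand B k F G w) := by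
  have hκ := normSqK_pos hk
  have hgau : ∀ z : R2 n, ‖gau (normSqK k / 4) (1 / 4) 0 0 z‖ ≤ 1 := fun z => by
    rw [norm_gau, inner_zero_left, Real.exp_le_one_iff]
    have h1 : 0 ≤ normSqK k / 4 * ‖z.fst‖ ^ 2 := by positivity
    have h2 : 0 ≤ 1 / 4 * ‖z.snd‖ ^ 2 := by positivity
    linarith
  have hc : Continuous fun z : R2 n =>
      kerHat (Matrix.toEuclideanLin (Bk B k)) (normSqK k) (w - z) z := by
    have := (Matrix.toEuclideanLin (Bk B k)).continuous_of_finiteDimensional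
    unfold kerHat sform
    simp only [WithLp.sub_fst, WithLp.sub_snd]
    fun_prop
  have h : Integrable fun z => kerHat (Matrix.toEuclideanLin (Bk B k)) (normSqK k) (w - z) z *
      (F (w - z) * G z) := by
    refine ((hF.comp_const_sub w).integrable_mul hG).bdd_mul (c := 1) hc.aestronglyMeasurable
      (Filter.Eventually.of_forall fun z => ?_)
    refine (norm_kerHat_le _ hκ (w - z) z).trans ?_
    rw [one_mul]
    exact mul_le_one₀ (hgau _) (norm_nonneg _) (hgau _)
  refine (h.const_mul (gau (normSqK k / 2) (1 / 2) 0 0 w)⁻¹).congr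
    (Filter.Eventually.of_forall fun z => ?_)
  have h0 : gau (normSqK k / 2) (1 / 2) 0 0 w ≠ 0 := Complex.exp_ne_zero _
  simp only
  rw [mul_comm (kerHat _ _ _ _), ← gau_mul_newConvIntegrand, inv_mul_cancel_left₀ h0]

theorem gau_mul_newConv (B : Fin m → Matrix (Fin n) (Fin n) ℝ) (k : Fin m → ℤ)
    (F G : R2 n → ℂ) (w : R2 n) :
    gau (normSqK k / 2) (1 / 2) 0 0 w * newConv B k F G w =
      ∫ z, F (w - z) * G z * kerHat (Matrix.toEuclideanLin (Bk B k)) (normSqK k) (w - z) z := by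
  simp_rw [newConv, ← integral_const_mul, gau_mul_newConvIntegrand]

theorem integral_twist_mul_ker {T S : E n →ₗ[ℝ] E n} {κ : ℝ} (hκ : 0 < κ)
    (hT : ∀ x, ‖T x‖ ^ 2 = κ * ‖x‖ ^ 2)
    (hS : ∀ x, ‖S x‖ ^ 2 = κ * ‖x‖ ^ 2) (hTS : ∀ x y, ⟪T x, y⟫_ℝ = ⟪x, S y⟫_ℝ)
    (hST : ∀ x, S (T x) = κ • x) {F G H : R2 n → ℂ} (a : R2 n)
    (h : ∫ z, H z * (cohKer T κ (twistMap T S κ a) z * cohKer T κ z (twistMap T S κ a)) =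
      ((((2 * π) ^ n * (√κ)⁻¹ ^ n)⁻¹ : ℝ) : ℂ) *
      ∫ z, F z * ∫ z', G z' * (cohKer T κ (twistMap T S κ a) z * cohKer T κ z z' *
        cohKer T κ z' (twistMap T S κ a))) :
    ∫ z, H (twistMap T S κ z) * (ker T κ a z * ker T κ z a) =
      ((2 * π : ℝ) : ℂ)⁻¹ ^ n * (((√κ)⁻¹ ^ n : ℝ) : ℂ) *
        ∫ z, F (twistMap T S κ z) * ∫ z', G (twistMap T S κ z') *
          (ker T κ a z * ker T κ z z' * ker T κ z' a) := by
  have hc : ((κ⁻¹ ^ n : ℝ) : ℂ) ≠ 0 := by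
    rw [Complex.ofReal_ne_zero]
    positivity
  -- The change of variables costs κ^{-n} on the left and κ^{-2n} on the right. The remaining κ^{-n}
  -- meets κ^{n/2} from the admissibility constant, leaving κ^{-n/2}.
  rw [integral_comp_twistMap hκ hT hS, integral_comp_twistMap hκ hT hS (fun z => F z * _)] at h
  simp_rw [integral_comp_twistMap hκ hT hS (fun z' => G z' * _),
    cohKer_twistMap hκ hT hS hTS hST, mul_left_comm (F _)] at h
  rw [integral_const_mul, mul_left_comm] at h
  rw [mul_left_cancel₀ hc h, ← mul_assoc]
  congr 1
  have hs : κ⁻¹ ^ n = (√κ)⁻¹ ^ n * (√κ)⁻¹ ^ n := by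
    rw [← mul_pow, ← mul_inv, Real.mul_self_sqrt hκ.le]
  have h1 : (√κ)⁻¹ ^ n ≠ 0 := by positivity
  rw [← Complex.ofReal_inv, ← Complex.ofReal_pow, ← Complex.ofReal_mul, ← Complex.ofReal_mul, hs,
    mul_inv, inv_pow (2 * π), mul_assoc, inv_mul_cancel_left₀ h1]

end ReducedHeisenberg

theorem mainTheorem4 {m n : ℕ} (B : Fin m → Matrix (Fin n) (Fin n) ℝ)
    (hB : ∀ j, B j ∈ Matrix.orthogonalGroup (Fin n) ℝ)
    (hBB : ∀ i j, i ≠ j → (B i)⁻¹ * B j = -((B j)⁻¹ * B i))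
    (k : Fin m → ℤ) (hk : k ≠ 0)
    (F G H : R2 n → ℂ)
    (hF : MemLp F 2 volume) (hG : MemLp G 2 volume) (hH : MemLp H 2 volume)
    (hprod : locOp B k (gaussWavelet n) H =
      locOp B k (gaussWavelet n) F ∘ locOp B k (gaussWavelet n) G) :
    (∀ w : R2 n, Integrable
      (newConvIntegrand B k (l2Fourier (twist B k F)) (l2Fourier (twist B k G)) w) volume) ∧
    l2Fourier (twist B k H) =ᵐ[volume] fun w =>
      ((2 * π : ℝ) : ℂ)⁻¹ ^ n *
        newConv B k (l2Fourier (twist B k F)) (l2Fourier (twist B k G)) w := by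
  refine ⟨integrable_newConvIntegrand B hk (memLp_l2Fourier _) (memLp_l2Fourier _), ?_⟩
  have hκ := normSqK_pos hk
  have hA := transpose_Bk_mul_Bk hB hBB k
  have hA' := mul_transpose_eq_smul_one hκ.ne' hA
  have hT := norm_sq_toEuclideanLin hA
  have hS := norm_sq_toEuclideanLin (A := (Bk B k).transpose) hA'
  have hTS := inner_toEuclideanLin (Bk B k)
  -- By definition `twist` is composition with `twistMap` for T = B_k, S = B_kᵗ and κ = ‖k‖². The
  -- operator identity is used at the coherent state of the twisted point.
  have key := l2Fourier_mul_gau_ae_eq hκ hT hS hTS (memLp_comp_twistMap hκ hT hS hF)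
    (memLp_comp_twistMap hκ hT hS hG) (memLp_comp_twistMap hκ hT hS hH) fun a =>
      integral_twist_mul_ker hκ hT hS hTS (toEuclideanLin_toEuclideanLin hA) a
        (integral_cohKer_eq_of_locOp_comp hκ hS hTS hF hG hH hprod rfl _)
  filter_upwards [key] with w hw
  have h0 : gau (normSqK k / 2) (1 / 2) 0 0 w ≠ 0 := Complex.exp_ne_zero _
  refine mul_right_cancel₀ h0 (hw.trans ?_)
  rw [mul_assoc, mul_comm (newConv _ _ _ _ _), gau_mul_newConv]
  rfl
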